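/- For a planar graph $G$, let $\mathrm{seg}(G)$ be the smallest number of segments in a crossing-free straight-line drawing of $G$ in the plane, where a segment of such a drawing is a maximal set of edges that together form a line segment. A graph is a $3$-tree if its vertices can be ordered so that the first four form a clique and, for every later vertex, its neighbours among the preceding vertices form a clique of size $3$. For $n \ge 6$, let $B_n$ be the graph with vertex set $\{v_1,\dots,v_n\}$ and edge set $\{v_1v_i,\, v_2v_i : 3\le i\le n\}\cup\{v_iv_{i+1} : 1\le i\le n-1\}$. Then, for every $n \ge 6$, $B_n$ is a planar $3$-tree with $n$ vertices and $$\mathrm{seg}(B_n) = \lceil 3n/2\rceil + 1.$$ -/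

import Mathlib

/-- The Euclidean plane. -/
abbrev Plane : Type := EuclideanSpace ℝ (Fin 2)

/-- For a placement `pos` of the vertices in the plane, the straight-line segment that joins the two
end vertices of `e`. -/
def edgeSegment {V : Type*} (pos : V → Plane) (e : Sym2 V) : Set Plane :=
  Sym2.lift ⟨fun u v => segment ℝ (pos u) (pos v), fun u v => segment_symm ℝ (pos u) (pos v)⟩ e

/-- The vertices are at distinct points, an edge, drawn as the point set `arc e`, passes through no
vertex except its own ends, and two different edges meet at most in a common end vertex. -/
structure IsCrossingFree {V : Type*} (G : SimpleGraph V) (pos : V → Plane)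
    (arc : Sym2 V → Set Plane) : Prop where
  injective : Function.Injective pos
  vertex : ∀ e ∈ G.edgeSet, ∀ w : V, pos w ∈ arc e → w ∈ e
  edge : ∀ e ∈ G.edgeSet, ∀ f ∈ G.edgeSet, e ≠ f →
    ∀ x ∈ arc e ∩ arc f, ∃ w : V, w ∈ e ∧ w ∈ f ∧ x = pos w

/-- A graph is planar if it has a crossing-free drawing in the plane in which each edge is a simple
(Jordan) arc between its two end vertices. -/
def IsPlanar {V : Type*} (G : SimpleGraph V) : Prop :=
  ∃ (pos : V → Plane) (arc : Sym2 V → Set Plane), IsCrossingFree G pos arc ∧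
    ∀ u v : V, G.Adj u v →
      ∃ γ : Path (pos u) (pos v), Function.Injective γ ∧ Set.range γ = arc s(u, v)

/-- A crossing-free straight-line drawing of `G`. -/
structure StraightLineDrawing {V : Type*} (G : SimpleGraph V) where
  /-- The positions of the vertices. -/
  pos : V → Plane
  crossingFree : IsCrossingFree G pos (edgeSegment pos)

/-- The edges in `S`, placed by `pos`, together form a (nondegenerate) line segment. -/
def FormsSegment {V : Type*} (pos : V → Plane) (S : Set (Sym2 V)) : Prop :=
  ∃ p q : Plane, p ≠ q ∧ ⋃ e ∈ S, edgeSegment pos e = segment ℝ p q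

/-- The segments of a straight-line drawing: the inclusion-maximal sets of edges that together form
a line segment. -/
def StraightLineDrawing.segments {V : Type*} {G : SimpleGraph V} (Γ : StraightLineDrawing G) :
    Set (Set (Sym2 V)) :=
  {S | Maximal (fun T => T ⊆ G.edgeSet ∧ FormsSegment Γ.pos T) S}

/-- The segment number of `G`: the smallest number of segments in a crossing-free straight-line
drawing of `G` (it is `⊤` if there is no such drawing). -/
noncomputable def seg {V : Type*} (G : SimpleGraph V) : ℕ∞ :=
  ⨅ Γ : StraightLineDrawing G, Γ.segments.encard

/-- `G` is a `k`-tree: it has a stacking order `v 0, v 1, …, v (n - 1)` of all its vertices, with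
`n ≥ k + 1`, in which the first `k + 1` vertices form a clique and the neighbours of each later
vertex among the vertices that precede it form a clique of size `k`. -/
def IsKTree {V : Type*} (k : ℕ) (G : SimpleGraph V) : Prop :=
  ∃ (n : ℕ) (v : Fin n ≃ V), k + 1 ≤ n ∧
    (∀ i j : Fin n, i.val < k + 1 → j.val < k + 1 → i ≠ j → G.Adj (v i) (v j)) ∧
    ∀ i : Fin n, k + 1 ≤ i.val →
      ∃ K : Finset V, G.IsNClique k K ∧ ∀ u : V, u ∈ K ↔ G.Adj u (v i) ∧ v.symm u < i

/-- The graph `B_n` with vertices `v_1, …, v_n` and edges `v_1 v_i`, `v_2 v_i` for `3 ≤ i ≤ n` and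
`v_i v_{i+1}` for `1 ≤ i ≤ n - 1`. The vertex `v_i` is the element `i - 1` of `Fin n`. -/
def graphB (n : ℕ) : SimpleGraph (Fin n) :=
  SimpleGraph.fromRel fun a b => (a.val < 2 ∧ 2 ≤ b.val) ∨ b.val = a.val + 1

/-!
The number of segments of a straight-line drawing is the number of edges minus the number of
straight passages `u → v → w` along two edges. Write `a`, `b` for the vertices `v_1`, `v_2` of `B_n`,
the apices, which are adjacent to all other vertices; the remaining vertices form a path with
`m = n - 2` vertices. There are `3 * n - 6 = 3 * m` edges, so the claim is that the largest number of
straight passages is `m - 4 + ⌊m / 2⌋`.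

*Lower bound on the number of segments.* If `v` is strictly between `u` and `w`, then `u` and `w` are
not adjacent. So an inner vertex of the path has at most one passage, along the path, and its end
vertices have none; a passage through an apex connects two vertices of the path, which lie on
different sides of the line `ab`. If the path does not cross this line, then at most `m - 2` passages
remain. If an edge `pq` of the path crosses it, then it does so outside the edge `ab`
(`mem_openTriangle_or`), so one apex `d` is in the interior of the triangle formed by `p`, `q` and the
other apex `c`. An edge from `d` cannot leave this triangle (`mem_triangle_of_adj`), so the triangle
contains the whole drawing, its corners `c`, `p`, `q` are extreme points and have no passages, and
there is no second crossing (`eq_of_mem_openTriangle`). Passages through `d` match vertices of the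
two parts into which `pq` divides the path, so their number is at most the size of the smaller part.
This gives the bound (`exists_passages`). To count segments by passages
(`card_le_encard_segments_add`), a linear functional orients the edges upwards; every segment has
only one edge that is not continued beyond its lower end.

*Upper bound.* In the drawing `posB` the two halves of the path are on two rays that are symmetric
with respect to the line `ab`, and the positions on the rays are chosen such that the lower apex is
on the segments between corresponding vertices of the two halves. Since different segments have no
edge in common (`segments_eq_of_mem`), it suffices to give one edge of each segment.
-/

/-! ### Sets of edges that form a segment -/

@[simp]
lemma edgeSegment_mk {V : Type*} (pos : V → Plane) (u v : V) :
    edgeSegment pos s(u, v) = segment ℝ (pos u) (pos v) := rfl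

/-- A set of edges that forms a segment and contains the edge `uv` covers an interval around
`[0, 1]` of the line through `u` and `v`, parametrised by `0 ↦ u`, `1 ↦ v`. -/
lemma FormsSegment.exists_param {V : Type*} {pos : V → Plane} {S : Set (Sym2 V)}
    (h : FormsSegment pos S) {u v : V} (he : s(u, v) ∈ S) (huv : pos u ≠ pos v) :
    ∃ s t : ℝ, s ≤ 0 ∧ 1 ≤ t ∧
      ⋃ e ∈ S, edgeSegment pos e = AffineMap.lineMap (pos u) (pos v) '' Set.Icc s t := by
  obtain ⟨p, q, hpq, hU⟩ := h
  have hsub : segment ℝ (pos u) (pos v) ⊆ segment ℝ p q := by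
    rw [← hU]; exact Set.subset_biUnion_of_mem (u := fun e => edgeSegment pos e) he
  have hu := hsub (left_mem_segment ℝ _ _)
  have hv := hsub (right_mem_segment ℝ _ _)
  rw [segment_eq_image_lineMap] at hu hv
  obtain ⟨α, ⟨hα0, hα1⟩, hα⟩ := hu
  obtain ⟨β, ⟨hβ0, hβ1⟩, hβ⟩ := hv
  have hne : β - α ≠ 0 := by
    intro h0
    apply huv
    rw [← hα, ← hβ, sub_eq_zero.1 h0]
  have hg : ∀ c : ℝ, AffineMap.lineMap (pos u) (pos v) ((c - α) / (β - α))
      = AffineMap.lineMap p q c := by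
    intro c
    rw [← hα, ← hβ, ← AffineMap.apply_lineMap]
    congr 1
    rw [AffineMap.lineMap_apply_ring']
    field_simp
    ring
  have hseg : segment ℝ p q = AffineMap.lineMap (pos u) (pos v) ''
      Set.Icc (min ((0 - α) / (β - α)) ((1 - α) / (β - α)))
        (max ((0 - α) / (β - α)) ((1 - α) / (β - α))) := by
    rw [← Set.uIcc, ← segment_eq_uIcc, image_segment, hg, hg, AffineMap.lineMap_apply_zero,
      AffineMap.lineMap_apply_one]
  refine ⟨_, _, ?_, ?_, hU.trans hseg⟩
  · rcases lt_or_gt_of_ne hne with h | h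
    · exact (min_le_right _ _).trans (div_nonpos_of_nonneg_of_nonpos (by linarith) h.le)
    · exact (min_le_left _ _).trans (div_nonpos_of_nonpos_of_nonneg (by linarith) h.le)
  · rcases lt_or_gt_of_ne hne with h | h
    · exact le_max_of_le_left ((one_le_div_of_neg h).2 (by linarith))
    · exact le_max_of_le_right ((one_le_div h).2 (by linarith))

lemma FormsSegment.of_param {V : Type*} {pos : V → Plane} {S : Set (Sym2 V)} {p q : Plane}
    (hpq : p ≠ q) {s t : ℝ} (hst : s < t)
    (h : ⋃ e ∈ S, edgeSegment pos e = AffineMap.lineMap p q '' Set.Icc s t) :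
    FormsSegment pos S := by
  refine ⟨AffineMap.lineMap p q s, AffineMap.lineMap p q t, ?_, ?_⟩
  · intro h0
    exact hst.ne (AffineMap.lineMap_injective ℝ hpq h0)
  · rw [h, ← segment_eq_Icc hst.le, image_segment]

lemma FormsSegment.union {V : Type*} {pos : V → Plane} {S T : Set (Sym2 V)}
    (hS : FormsSegment pos S) (hT : FormsSegment pos T) {u v : V} (huS : s(u, v) ∈ S)
    (huT : s(u, v) ∈ T) (huv : pos u ≠ pos v) : FormsSegment pos (S ∪ T) := by
  obtain ⟨s, t, hs, ht, h⟩ := hS.exists_param huS huv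
  obtain ⟨s', t', hs', ht', h'⟩ := hT.exists_param huT huv
  refine FormsSegment.of_param huv (s := min s s') (t := max t t')
    (by linarith [min_le_left s s', le_max_left t t']) ?_
  rw [Set.biUnion_union, h, h', ← Set.image_union, Set.Icc_union_Icc' (by linarith) (by linarith)]

lemma formsSegment_singleton {V : Type*} {pos : V → Plane} {u v : V} (huv : pos u ≠ pos v) :
    FormsSegment pos {s(u, v)} :=
  ⟨pos u, pos v, huv, by simp⟩

/-- Two edges that continue each other form a segment. -/
lemma formsSegment_pair {V : Type*} {pos : V → Plane} {u v w : V}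
    (h : Sbtw ℝ (pos u) (pos v) (pos w)) : FormsSegment pos {s(u, v), s(v, w)} := by
  refine ⟨pos u, pos w, h.left_ne_right, ?_⟩
  rw [Set.biUnion_pair, edgeSegment_mk, edgeSegment_mk]
  obtain ⟨⟨t, ⟨ht0, ht1⟩, ht⟩, -, -⟩ := h
  have h1 := image_segment ℝ (AffineMap.lineMap (pos u) (pos w) : ℝ →ᵃ[ℝ] Plane) 0 t
  have h2 := image_segment ℝ (AffineMap.lineMap (pos u) (pos w) : ℝ →ᵃ[ℝ] Plane) t 1
  have h3 := image_segment ℝ (AffineMap.lineMap (pos u) (pos w) : ℝ →ᵃ[ℝ] Plane) 0 1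
  simp only [ht, AffineMap.lineMap_apply_zero, AffineMap.lineMap_apply_one] at h1 h2 h3
  rw [← h1, ← h2, ← h3, ← Set.image_union, segment_eq_Icc ht0, segment_eq_Icc ht1,
    segment_eq_Icc zero_le_one, Set.Icc_union_Icc_eq_Icc ht0 ht1]

/-! ### Segments of a drawing -/

namespace StraightLineDrawing

variable {V : Type*} {G : SimpleGraph V} (Γ : StraightLineDrawing G)

lemma mem_segments {S : Set (Sym2 V)} : S ∈ Γ.segments ↔
    Maximal (fun T => T ⊆ G.edgeSet ∧ FormsSegment Γ.pos T) S := Iff.rfl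

lemma pos_ne {u v : V} (h : G.Adj u v) : Γ.pos u ≠ Γ.pos v :=
  fun h' => h.ne (Γ.crossingFree.injective h')

lemma eq_or_eq_of_mem_segment {u v w : V} (h : G.Adj u v)
    (hw : Γ.pos w ∈ segment ℝ (Γ.pos u) (Γ.pos v)) : w = u ∨ w = v :=
  Sym2.mem_iff.1 (Γ.crossingFree.vertex s(u, v) h w hw)

/-- Different segments of a drawing have no edge in common. -/
lemma segments_eq_of_mem {S T : Set (Sym2 V)} (hS : S ∈ Γ.segments) (hT : T ∈ Γ.segments)
    {e : Sym2 V} (heS : e ∈ S) (heT : e ∈ T) : S = T := by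
  rw [mem_segments] at hS hT
  induction e with
  | _ u v =>
    have huv := Γ.pos_ne (hS.prop.1 heS)
    have hU : S ∪ T ⊆ G.edgeSet ∧ FormsSegment Γ.pos (S ∪ T) :=
      ⟨Set.union_subset hS.prop.1 hT.prop.1, hS.prop.2.union hT.prop.2 heS heT huv⟩
    exact (hS.eq_of_subset hU Set.subset_union_left).trans
      (hT.eq_of_subset hU Set.subset_union_right).symm

lemma nonempty_of_mem_segments {S : Set (Sym2 V)} (hS : S ∈ Γ.segments) : S.Nonempty := by
  by_contra h
  obtain ⟨p, q, -, hU⟩ := (Γ.mem_segments.1 hS).prop.2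
  rw [Set.not_nonempty_iff_eq_empty.1 h] at hU
  have := left_mem_segment ℝ p q
  rw [← hU] at this
  simp at this

/-- A segment of a drawing continues straight through a vertex as long as an edge does. -/
lemma mem_of_sbtw {S : Set (Sym2 V)} (hS : S ∈ Γ.segments) {u v w : V} (huv : s(u, v) ∈ S)
    (hvw : G.Adj v w) (h : Sbtw ℝ (Γ.pos u) (Γ.pos v) (Γ.pos w)) : s(v, w) ∈ S := by
  rw [mem_segments] at hS
  have huv' : G.Adj u v := hS.prop.1 huv
  have hU : S ∪ {s(u, v), s(v, w)} ⊆ G.edgeSet ∧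
      FormsSegment Γ.pos (S ∪ {s(u, v), s(v, w)}) := by
    refine ⟨Set.union_subset hS.prop.1 ?_, hS.prop.2.union (formsSegment_pair h) huv (by simp)
      (Γ.pos_ne huv')⟩
    rintro e (rfl | rfl)
    · exact huv'
    · exact hvw
  rw [hS.eq_of_subset hU Set.subset_union_left]
  simp

lemma exists_mem_segments [Finite V] {e : Sym2 V} (he : e ∈ G.edgeSet) :
    ∃ S ∈ Γ.segments, e ∈ S := by
  induction e with
  | _ u v =>
    obtain ⟨S, hle, hS⟩ := (Set.toFinite
      {T : Set (Sym2 V) | T ⊆ G.edgeSet ∧ FormsSegment Γ.pos T}).exists_le_maximal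
      (a := {s(u, v)}) ⟨by simpa using he, formsSegment_singleton (Γ.pos_ne he)⟩
    exact ⟨S, hS, hle rfl⟩

/-- If every segment contains an edge of `R`, then there are at most `R.card` segments. -/
lemma encard_segments_le (R : Finset (Sym2 V))
    (hR : ∀ S ∈ Γ.segments, ∃ e ∈ R, e ∈ S) : Γ.segments.encard ≤ R.card := by
  obtain h | ⟨S₀, hS₀⟩ := Γ.segments.eq_empty_or_nonempty
  · simp [h]
  obtain ⟨e₀, -, -⟩ := hR S₀ hS₀
  have : Nonempty (Sym2 V) := ⟨e₀⟩
  choose! f hf using hR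
  rw [← Set.encard_coe_eq_coe_finsetCard]
  refine Set.encard_le_encard_of_injOn (f := f) (fun S hS => (hf S hS).1) ?_
  intro S hS T hT hST
  exact Γ.segments_eq_of_mem hS hT (hf S hS).2 (hST ▸ (hf T hT).2)

/-- If the segment formed by `S` extends beyond the end `u` of the edge `uv`, then some edge of `S`
continues `uv` straight through `u`. -/
lemma exists_sbtw_of_param [Finite V] {S : Set (Sym2 V)} (hSG : S ⊆ G.edgeSet) {u v : V}
    (huv : Γ.pos u ≠ Γ.pos v) {s t : ℝ} (hs : s < 0) (ht : 0 ≤ t)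
    (h : ⋃ e ∈ S, edgeSegment Γ.pos e = AffineMap.lineMap (Γ.pos u) (Γ.pos v) '' Set.Icc s t) :
    ∃ w, s(u, w) ∈ S ∧ Sbtw ℝ (Γ.pos w) (Γ.pos u) (Γ.pos v) := by
  set g : ℝ →ᵃ[ℝ] Plane := AffineMap.lineMap (Γ.pos u) (Γ.pos v) with hg
  -- The edges of `S` that avoid `u` form a closed set, so they avoid a neighbourhood of `u`.
  have hclosed : IsClosed (⋃ e ∈ {e ∈ S | u ∉ e}, edgeSegment Γ.pos e) := by
    refine Set.Finite.isClosed_biUnion (Set.toFinite _) ?_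
    intro e _
    induction e with
    | _ x y =>
      rw [edgeSegment_mk, segment_eq_image_lineMap]
      exact (isCompact_Icc.image (by fun_prop)).isClosed
  have hnot : g 0 ∉ ⋃ e ∈ {e ∈ S | u ∉ e}, edgeSegment Γ.pos e := by
    simp only [Set.mem_iUnion, not_exists, hg, AffineMap.lineMap_apply_zero]
    rintro e ⟨heS, hue⟩ hmem
    exact hue (Γ.crossingFree.vertex e (hSG heS) u hmem)
  have hgc : Continuous g := AffineMap.lineMap_continuous
  have hev : ∀ᶠ x in nhdsWithin (0 : ℝ) (Set.Iio 0),
      g x ∉ ⋃ e ∈ {e ∈ S | u ∉ e}, edgeSegment Γ.pos e :=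
    (hgc.continuousAt.eventually (hclosed.isOpen_compl.mem_nhds hnot)).filter_mono
      nhdsWithin_le_nhds
  obtain ⟨x, hx, hxs, hx0⟩ := (hev.and (Ioo_mem_nhdsLT hs)).exists
  have hmem : g x ∈ ⋃ e ∈ S, edgeSegment Γ.pos e := by
    rw [h]; exact ⟨x, ⟨hxs.le, hx0.le.trans ht⟩, rfl⟩
  simp only [Set.mem_iUnion] at hmem
  obtain ⟨e, heS, hxe⟩ := hmem
  have hue : u ∈ e := by
    by_contra hue
    exact hx (Set.mem_biUnion (show e ∈ {e ∈ S | u ∉ e} from ⟨heS, hue⟩) hxe)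
  obtain ⟨w, rfl⟩ := hue
  refine ⟨w, heS, ?_⟩
  rw [edgeSegment_mk] at hxe
  have h1 : Wbtw ℝ (Γ.pos u) (g x) (Γ.pos w) := mem_segment_iff_wbtw.1 hxe
  have h2 : Sbtw ℝ (g x) (Γ.pos u) (Γ.pos v) := by
    have h3 : Sbtw ℝ x 0 1 := by
      refine ⟨⟨-x / (1 - x), ⟨div_nonneg (by linarith) (by linarith),
        (div_le_one (by linarith)).2 (by linarith)⟩, ?_⟩, hx0.ne', zero_ne_one⟩
      have : (1 - x) ≠ 0 := by linarith
      rw [AffineMap.lineMap_apply_ring']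
      field_simp
      ring
    have h4 := (AffineMap.lineMap_injective ℝ huv).sbtw_map_iff.2 h3
    rwa [AffineMap.lineMap_apply_zero, AffineMap.lineMap_apply_one] at h4
  exact ⟨h1.symm.trans_expand_right h2.wbtw h2.left_ne, Γ.pos_ne (hSG heS), h2.ne_right⟩

end StraightLineDrawing

/-! ### Counting segments by straight passages through vertices -/

/-- Some linear functional separates finitely many points of the plane. -/
lemma exists_injective_functional {V : Type*} [Finite V] {pos : V → Plane}
    (h : Function.Injective pos) : ∃ ℓ : Plane →ₗ[ℝ] ℝ, Function.Injective fun v => ℓ (pos v) := by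
  obtain ⟨c, hc⟩ := (Set.finite_range fun p : V × V =>
    -((pos p.1 0 - pos p.2 0) / (pos p.1 1 - pos p.2 1))).exists_notMem
  refine ⟨{ toFun := fun x => x 0 + c * x 1, map_add' := ?_, map_smul' := ?_ }, ?_⟩
  · intro x y; simp; ring
  · intro r x; simp; ring
  intro u v huv
  simp only [LinearMap.coe_mk, AddHom.coe_mk] at huv
  by_cases h1 : pos u 1 - pos v 1 = 0
  · apply h
    have h1' : pos u 1 = pos v 1 := sub_eq_zero.1 h1
    have h0 : pos u 0 = pos v 0 := by rw [h1'] at huv; linarith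
    ext i
    fin_cases i
    · exact h0
    · exact h1'
  · exfalso
    apply hc
    refine ⟨(u, v), ?_⟩
    simp only
    field_simp
    linarith

lemma lt_of_sbtw {ℓ : Plane →ₗ[ℝ] ℝ} {p q r : Plane} (h : Sbtw ℝ p q r) (hqr : ℓ q < ℓ r) :
    ℓ p < ℓ q := by
  obtain ⟨⟨t, ⟨ht0, ht1⟩, ht⟩, h1, h2⟩ := h
  have ht0' : t ≠ 0 := by rintro rfl; simp at ht; exact h1 ht.symm
  have h3 : ℓ q = (1 - t) * ℓ p + t * ℓ r := by
    rw [← ht, AffineMap.lineMap_apply_module]; simp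
  have : 0 < t := lt_of_le_of_ne ht0 ht0'.symm
  nlinarith

namespace StraightLineDrawing

variable {V : Type*} {G : SimpleGraph V} (Γ : StraightLineDrawing G)

/-- If no edge continues the edge `uv` of a segment beyond `u`, then the segment lies on the ray
from `u` through `v`. -/
lemma exists_param_of_not_sbtw [Finite V] {S : Set (Sym2 V)} (hS : S ∈ Γ.segments)
    {u v : V} (huv : s(u, v) ∈ S)
    (h : ∀ w, G.Adj u w → ¬ Sbtw ℝ (Γ.pos w) (Γ.pos u) (Γ.pos v)) {x : V} {e : Sym2 V}
    (he : e ∈ S) (hx : x ∈ e) :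
    ∃ r : ℝ, 0 ≤ r ∧ Γ.pos x = AffineMap.lineMap (Γ.pos u) (Γ.pos v) r := by
  rw [mem_segments] at hS
  have hne := Γ.pos_ne (hS.prop.1 huv)
  obtain ⟨s, t, hs, ht, hU⟩ := hS.prop.2.exists_param huv hne
  have hs0 : ¬ s < 0 := by
    intro hs0
    obtain ⟨w, hw, hb⟩ := Γ.exists_sbtw_of_param hS.prop.1 hne hs0 (by linarith) hU
    exact h w (hS.prop.1 hw) hb
  have hmem : Γ.pos x ∈ ⋃ e ∈ S, edgeSegment Γ.pos e := by
    obtain ⟨y, rfl⟩ := hx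
    exact Set.mem_biUnion he (left_mem_segment ℝ _ _)
  rw [hU] at hmem
  obtain ⟨r, hr, hr'⟩ := hmem
  exact ⟨r, by linarith [hr.1], hr'.symm⟩

lemma eq_of_same_ray {u v w : V} (huv : G.Adj u v) (huw : G.Adj u w) {r : ℝ} (hr : 0 ≤ r)
    (h : Γ.pos w = AffineMap.lineMap (Γ.pos u) (Γ.pos v) r) : w = v := by
  rcases le_total r 1 with h1 | h1
  · have : Γ.pos w ∈ segment ℝ (Γ.pos u) (Γ.pos v) := by
      rw [h, segment_eq_image_lineMap]; exact ⟨r, ⟨hr, h1⟩, rfl⟩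
    exact (Γ.eq_or_eq_of_mem_segment huv this).resolve_left huw.ne'
  · have : Γ.pos v ∈ segment ℝ (Γ.pos u) (Γ.pos w) := by
      rw [h, segment_eq_image_lineMap]
      refine ⟨1 / r, ⟨by positivity, (div_le_one (by linarith)).2 h1⟩, ?_⟩
      rw [AffineMap.lineMap_lineMap_right, div_mul_cancel₀ _ (by linarith),
        AffineMap.lineMap_apply_one]
    exact ((Γ.eq_or_eq_of_mem_segment huw this).resolve_left huv.ne').symm

/-- Let the finite set `P` contain, in one of the two directions, each straight passage
`u → v → w` of the drawing along two edges. Then the number of edges is at most the number of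
segments plus the number of passages. -/
theorem card_le_encard_segments_add [Finite V] (F : Finset (Sym2 V))
    (hF : ∀ e ∈ F, e ∈ G.edgeSet) (P : Finset (V × V × V))
    (hP : ∀ u v w, G.Adj u v → G.Adj v w → Sbtw ℝ (Γ.pos u) (Γ.pos v) (Γ.pos w) →
      (u, v, w) ∈ P ∨ (w, v, u) ∈ P) :
    (F.card : ℕ∞) ≤ Γ.segments.encard + P.card := by
  classical
  obtain ⟨ℓ, hℓ⟩ := exists_injective_functional Γ.crossingFree.injective
  -- Edges that are continued beyond their lower ends correspond to passages; of the remaining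
  -- edges, each segment contains only the lowest one.
  let X : Finset (Sym2 V) := F.filter fun e => ∃ u v w, e = s(u, v) ∧
    ℓ (Γ.pos u) < ℓ (Γ.pos v) ∧ G.Adj u w ∧ Sbtw ℝ (Γ.pos w) (Γ.pos u) (Γ.pos v)
  have hX : X.card ≤ P.card := by
    refine (Finset.card_le_card (t := P.image fun p => s(p.2.1,
      if ℓ (Γ.pos p.1) < ℓ (Γ.pos p.2.2) then p.2.2 else p.1)) ?_).trans Finset.card_image_le
    intro e he
    obtain ⟨heF, u, v, w, rfl, hlt, huw, hb⟩ := Finset.mem_filter.1 he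
    have hlt' := lt_of_sbtw hb hlt
    rw [Finset.mem_image]
    rcases hP w u v huw.symm (hF _ heF) hb with h | h
    · exact ⟨_, h, by simp [hlt'.trans hlt]⟩
    · exact ⟨_, h, by simp [(hlt'.trans hlt).le]⟩
  have hY : ((F \ X).card : ℕ∞) ≤ Γ.segments.encard := by
    choose! f hfS hfe using fun e (he : e ∈ F) => Γ.exists_mem_segments (hF e he)
    rw [← Set.encard_coe_eq_coe_finsetCard]
    refine Set.encard_le_encard_of_injOn (f := f)
      (fun e he => hfS e (Finset.mem_sdiff.1 (Finset.mem_coe.1 he)).1) ?_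
    have key : ∀ e ∈ F \ X, ∃ u v, e = s(u, v) ∧ ℓ (Γ.pos u) < ℓ (Γ.pos v) ∧
        ∀ w, G.Adj u w → ¬ Sbtw ℝ (Γ.pos w) (Γ.pos u) (Γ.pos v) := by
      intro e he
      obtain ⟨heF, heX⟩ := Finset.mem_sdiff.1 he
      have : ∃ u v, e = s(u, v) ∧ ℓ (Γ.pos u) < ℓ (Γ.pos v) := by
        induction e with
        | _ u v =>
          have huv : G.Adj u v := hF _ heF
          rcases lt_or_gt_of_ne (fun h => huv.ne (hℓ h)) with h | h
          · exact ⟨u, v, rfl, h⟩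
          · exact ⟨v, u, Sym2.eq_swap, h⟩
      obtain ⟨u, v, rfl, hlt⟩ := this
      exact ⟨u, v, rfl, hlt, fun w hw hb =>
        heX (Finset.mem_filter.2 ⟨heF, u, v, w, rfl, hlt, hw, hb⟩)⟩
    intro e he e' he' hff
    have heF := (Finset.mem_sdiff.1 (Finset.mem_coe.1 he)).1
    have heF' := (Finset.mem_sdiff.1 (Finset.mem_coe.1 he')).1
    obtain ⟨u, v, rfl, hlt, hn⟩ := key e he
    obtain ⟨u', v', rfl, hlt', hn'⟩ := key e' he'
    have hS := hfS _ heF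
    have hm := hfe _ heF
    have hm' := hfe _ heF'
    rw [← hff] at hm'
    have hle : ∀ {a b c : V} {r : ℝ}, ℓ (Γ.pos a) < ℓ (Γ.pos b) → 0 ≤ r →
        Γ.pos c = AffineMap.lineMap (Γ.pos a) (Γ.pos b) r → ℓ (Γ.pos a) ≤ ℓ (Γ.pos c) := by
      intro a b c r hab hr hc
      rw [hc, AffineMap.lineMap_apply_module]
      simp only [map_add, map_smul, smul_eq_mul]
      nlinarith
    obtain ⟨r, hr, hr'⟩ := Γ.exists_param_of_not_sbtw hS hm hn hm' (Sym2.mem_mk_left u' v')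
    obtain ⟨r₁, hr₁, hr₁'⟩ := Γ.exists_param_of_not_sbtw hS hm' hn' hm (Sym2.mem_mk_left u v)
    have huu : u = u' := hℓ (le_antisymm (hle hlt hr hr') (hle hlt' hr₁ hr₁'))
    subst huu
    obtain ⟨r₂, hr₂, hr₂'⟩ := Γ.exists_param_of_not_sbtw hS hm hn hm' (Sym2.mem_mk_right u v')
    have hvv : v' = v := Γ.eq_of_same_ray (hF _ heF) (hF _ heF') hr₂ hr₂'
    rw [hvv]
  have hFc : F.card = X.card + (F \ X).card := by
    rw [add_comm, Finset.card_sdiff_add_card_eq_card (Finset.filter_subset _ _)]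
  rw [hFc, add_comm]
  push_cast
  exact add_le_add hY (by exact_mod_cast hX)

end StraightLineDrawing

/-! ### Triangles -/

/-- Twice the signed area of the triangle `a b x`; its sign tells on which side of the line `ab` the
point `x` lies. -/
def side (a b x : Plane) : ℝ := (b 0 - a 0) * (x 1 - a 1) - (b 1 - a 1) * (x 0 - a 0)

@[simp] lemma side_left (a b : Plane) : side a b a = 0 := by simp [side]

@[simp] lemma side_right (a b : Plane) : side a b b = 0 := by simp [side]; ring

lemma side_combination (a b p q r : Plane) {α β γ : ℝ} (h : α + β + γ = 1) :
    side a b (α • p + β • q + γ • r) = α * side a b p + β * side a b q + γ * side a b r := by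
  obtain rfl : α = 1 - β - γ := by linarith
  simp [side]; ring

lemma side_lineMap (a b p q : Plane) (t : ℝ) :
    side a b (AffineMap.lineMap p q t) = (1 - t) * side a b p + t * side a b q := by
  rw [AffineMap.lineMap_apply_module]
  simp [side]; ring

lemma wbtw_of_side_eq_zero {a b x : Plane} (hab : a ≠ b) (h : side a b x = 0) :
    Wbtw ℝ a b x ∨ Wbtw ℝ b x a ∨ Wbtw ℝ x a b := by
  apply Collinear.wbtw_or_wbtw_or_wbtw
  rw [collinear_iff_of_mem (p₀ := a) (by simp)]
  refine ⟨b - a, ?_⟩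
  intro p hp
  simp only [Set.mem_insert_iff, Set.mem_singleton_iff] at hp
  rcases hp with rfl | rfl | rfl
  · exact ⟨0, by simp⟩
  · exact ⟨1, by simp⟩
  · simp only [side] at h
    by_cases h0 : b 0 - a 0 = 0
    · have h1 : b 1 - a 1 ≠ 0 := by
        intro h1
        apply hab
        ext i; fin_cases i
        · simp; linarith
        · simp; linarith
      refine ⟨(p 1 - a 1) / (b 1 - a 1), ?_⟩
      have h2 : p 0 - a 0 = 0 := by
        rw [h0, zero_mul, zero_sub, neg_eq_zero] at h
        exact (mul_eq_zero.1 h).resolve_left h1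
      ext i; fin_cases i
      · simp [h0]; linarith
      · simp; field_simp; ring
    · refine ⟨(p 0 - a 0) / (b 0 - a 0), ?_⟩
      ext i; fin_cases i
      · simp; field_simp; ring
      · simp; field_simp; linarith

/-- Barycentric coordinates with respect to the triangle `c p q`. -/
lemma eq_barycentric {c p q : Plane} (h : side c p q ≠ 0) (x : Plane) :
    x = (side p q x / side c p q) • c + (side q c x / side c p q) • p +
      (side c p x / side c p q) • q := by
  ext i
  fin_cases i
  · simp
    field_simp
    simp [side]
    ring
  · simp
    field_simp
    simp [side]
    ring

lemma side_add_side_add_side (c p q x : Plane) :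
    side p q x + side q c x + side c p x = side c p q := by
  simp [side]; ring

/-- The closed triangle with corners `c`, `p`, `q`. -/
def triangle (c p q : Plane) : Set Plane :=
  {x | ∃ α β γ : ℝ, 0 ≤ α ∧ 0 ≤ β ∧ 0 ≤ γ ∧ α + β + γ = 1 ∧ x = α • c + β • p + γ • q}

/-- The open triangle with corners `c`, `p`, `q`. -/
def openTriangle (c p q : Plane) : Set Plane :=
  {x | ∃ α β γ : ℝ, 0 < α ∧ 0 < β ∧ 0 < γ ∧ α + β + γ = 1 ∧ x = α • c + β • p + γ • q}

lemma openTriangle_subset (c p q : Plane) : openTriangle c p q ⊆ triangle c p q := by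
  rintro x ⟨α, β, γ, hα, hβ, hγ, h⟩
  exact ⟨α, β, γ, hα.le, hβ.le, hγ.le, h⟩

lemma triangle_swap (c p q : Plane) : triangle c p q ⊆ triangle p c q := by
  rintro x ⟨α, β, γ, hα, hβ, hγ, h, rfl⟩
  exact ⟨β, α, γ, hβ, hα, hγ, by linarith, by abel⟩

lemma triangle_rotate (c p q : Plane) : triangle c p q ⊆ triangle q c p := by
  rintro x ⟨α, β, γ, hα, hβ, hγ, h, rfl⟩
  exact ⟨γ, α, β, hγ, hα, hβ, by linarith, by abel⟩

namespace StraightLineDrawing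

variable {V : Type*} {G : SimpleGraph V} (Γ : StraightLineDrawing G)

lemma not_adj_of_sbtw {u v w : V} (h : Sbtw ℝ (Γ.pos u) (Γ.pos v) (Γ.pos w)) : ¬ G.Adj u w := by
  intro huw
  rcases Γ.eq_or_eq_of_mem_segment huw (mem_segment_iff_wbtw.2 h.wbtw) with rfl | rfl
  · exact h.ne_left rfl
  · exact h.ne_right rfl

lemma notMem_segment_of_mem_segment {u v x y : V} (huv : G.Adj u v) (hxy : G.Adj x y)
    (h1 : u ≠ x) (h2 : u ≠ y) (h3 : v ≠ x) (h4 : v ≠ y) {z : Plane}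
    (hz : z ∈ segment ℝ (Γ.pos u) (Γ.pos v)) : z ∉ segment ℝ (Γ.pos x) (Γ.pos y) := by
  intro hz'
  have hne : s(u, v) ≠ s(x, y) := by
    intro h
    rcases Sym2.eq_iff.1 h with h | h
    · exact h1 h.1
    · exact h2 h.1
  obtain ⟨w, hw, hw', -⟩ := Γ.crossingFree.edge s(u, v) huv s(x, y) hxy hne z ⟨hz, hz'⟩
  rcases Sym2.mem_iff.1 hw with rfl | rfl <;> rcases Sym2.mem_iff.1 hw' with rfl | rfl <;>
    contradiction

lemma side_ne_zero {u v w : V} (huv : G.Adj u v) (hvw : G.Adj v w) (huw : G.Adj u w) :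
    side (Γ.pos u) (Γ.pos v) (Γ.pos w) ≠ 0 := by
  intro h
  rcases wbtw_of_side_eq_zero (Γ.pos_ne huv) h with h | h | h
  · rcases Γ.eq_or_eq_of_mem_segment huw (mem_segment_iff_wbtw.2 h) with h | h
    · exact huv.ne' h
    · exact hvw.ne h
  · rcases Γ.eq_or_eq_of_mem_segment huv.symm (mem_segment_iff_wbtw.2 h) with h | h
    · exact hvw.ne' h
    · exact huw.ne' h
  · rcases Γ.eq_or_eq_of_mem_segment hvw.symm (mem_segment_iff_wbtw.2 h) with h | h
    · exact huw.ne h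
    · exact huv.ne h

/-- If the line through the edge `cd` separates the ends of the edge `pq`, where `c`, `d`, `p`, `q`
form a clique, then it meets `pq` beyond `c` or beyond `d`. -/
lemma mem_openTriangle_or {c d p q : V} (hcd : G.Adj c d) (hcp : G.Adj c p) (hcq : G.Adj c q)
    (hdp : G.Adj d p) (hdq : G.Adj d q) (hpq : G.Adj p q)
    (h : side (Γ.pos c) (Γ.pos d) (Γ.pos p) * side (Γ.pos c) (Γ.pos d) (Γ.pos q) < 0) :
    Γ.pos d ∈ openTriangle (Γ.pos c) (Γ.pos p) (Γ.pos q) ∨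
      Γ.pos c ∈ openTriangle (Γ.pos d) (Γ.pos p) (Γ.pos q) := by
  set P := side (Γ.pos c) (Γ.pos d) (Γ.pos p) with hP
  set Q := side (Γ.pos c) (Γ.pos d) (Γ.pos q) with hQ
  obtain ⟨t, ht0, ht1, ht⟩ : ∃ t : ℝ, 0 < t ∧ t < 1 ∧ (1 - t) * P + t * Q = 0 := by
    have hne : P - Q ≠ 0 := by
      intro h0
      have : P = Q := by linarith
      rw [this] at h
      nlinarith
    refine ⟨P / (P - Q), ?_, ?_, by field_simp; ring⟩
    · rcases mul_neg_iff.1 h with ⟨h1, h2⟩ | ⟨h1, h2⟩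
      · exact div_pos h1 (by linarith)
      · exact div_pos_of_neg_of_neg h1 (by linarith)
    · rcases mul_neg_iff.1 h with ⟨h1, h2⟩ | ⟨h1, h2⟩
      · rw [div_lt_one (by linarith)]; linarith
      · rw [div_lt_one_of_neg (by linarith)]; linarith
  set x : Plane := AffineMap.lineMap (Γ.pos p) (Γ.pos q) t with hx
  have hx0 : side (Γ.pos c) (Γ.pos d) x = 0 := by rw [hx, side_lineMap]; exact ht
  have hxs : x ∈ segment ℝ (Γ.pos p) (Γ.pos q) := by
    rw [segment_eq_image_lineMap]; exact ⟨t, ⟨ht0.le, ht1.le⟩, rfl⟩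
  have key : ∀ c d : V, Γ.pos c ≠ Γ.pos d → Γ.pos d ≠ x → Wbtw ℝ (Γ.pos c) (Γ.pos d) x →
      Γ.pos d ∈ openTriangle (Γ.pos c) (Γ.pos p) (Γ.pos q) := by
    rintro c d hcd hdx ⟨r, ⟨hr0, hr1⟩, hr⟩
    have hr0' : 0 < r := lt_of_le_of_ne hr0 (by rintro rfl; apply hcd; simpa using hr)
    have hr1' : r < 1 := lt_of_le_of_ne hr1 (by rintro rfl; apply hdx; simpa using hr.symm)
    refine ⟨1 - r, r * (1 - t), r * t, by linarith, mul_pos hr0' (by linarith),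
      mul_pos hr0' ht0, by ring, ?_⟩
    rw [← hr, hx, AffineMap.lineMap_apply_module, AffineMap.lineMap_apply_module]
    module
  have hvert : ∀ v, v ≠ p → v ≠ q → Γ.pos v ≠ x := by
    intro v h1 h2 hv
    rw [← hv] at hxs
    rcases Γ.eq_or_eq_of_mem_segment hpq hxs with h | h
    · exact h1 h
    · exact h2 h
  rcases wbtw_of_side_eq_zero (Γ.pos_ne hcd) hx0 with h | h | h
  · exact Or.inl (key c d (Γ.pos_ne hcd) (hvert d hdp.ne hdq.ne) h)
  · exact absurd hxs (Γ.notMem_segment_of_mem_segment hcd.symm hpq hdp.ne hdq.ne hcp.ne hcq.ne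
      (mem_segment_iff_wbtw.2 h))
  · exact Or.inr (key d c (Γ.pos_ne hcd.symm) (hvert c hcp.ne hcq.ne) h.symm)

/-- An edge from a vertex `d` inside the triangle `c p q` cannot leave the triangle. -/
lemma mem_triangle_of_adj {c d p q w : V} (hcp : G.Adj c p) (hcq : G.Adj c q)
    (hpq : G.Adj p q) (hdc : d ≠ c) (hdp : d ≠ p) (hdq : d ≠ q)
    (hd : Γ.pos d ∈ openTriangle (Γ.pos c) (Γ.pos p) (Γ.pos q)) (hdw : G.Adj d w) :
    Γ.pos w ∈ triangle (Γ.pos c) (Γ.pos p) (Γ.pos q) := by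
  by_cases hwc : w = c
  · subst hwc; exact ⟨1, 0, 0, by norm_num, le_rfl, le_rfl, by norm_num, by simp⟩
  by_cases hwp : w = p
  · subst hwp; exact ⟨0, 1, 0, le_rfl, by norm_num, le_rfl, by norm_num, by simp⟩
  by_cases hwq : w = q
  · subst hwq; exact ⟨0, 0, 1, le_rfl, le_rfl, by norm_num, by norm_num, by simp⟩
  by_contra hw
  have hD := Γ.side_ne_zero hcp hpq hcq
  set C := Γ.pos c
  set P := Γ.pos p
  set Q := Γ.pos q
  -- The smallest barycentric coordinate changes its sign along the edge `dw`, so it vanishes at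
  -- some point of the edge; that point is on the boundary of the triangle.
  set f : Plane → ℝ := fun x =>
    min (side P Q x / side C P Q) (min (side Q C x / side C P Q) (side C P x / side C P Q)) with hf
  have hsum : ∀ x, side P Q x / side C P Q + side Q C x / side C P Q + side C P x / side C P Q
      = 1 := by
    intro x
    rw [← add_div, ← add_div, side_add_side_add_side, div_self hD]
  have hfd : 0 < f (Γ.pos d) := by
    obtain ⟨α, β, γ, hα, hβ, hγ, h1, h2⟩ := hd
    have e1 : side P Q C = side C P Q := by simp [side]; ring
    have e2 : side Q C P = side C P Q := by simp [side]; ring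
    simp only [hf, h2, side_combination _ _ _ _ _ h1, side_left, side_right, e1, e2, mul_zero,
      add_zero, zero_add, mul_div_cancel_right₀ _ hD, lt_min_iff]
    exact ⟨hα, hβ, hγ⟩
  have hfw : f (Γ.pos w) < 0 := by
    by_contra h
    simp only [hf, not_lt, le_min_iff] at h
    exact hw ⟨_, _, _, h.1, h.2.1, h.2.2, hsum _, eq_barycentric hD _⟩
  have hcont : Continuous fun t : ℝ => f (AffineMap.lineMap (Γ.pos d) (Γ.pos w) t) := by
    simp only [hf, side_lineMap]
    fun_prop
  obtain ⟨t, ht, ht0⟩ : (0 : ℝ) ∈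
      (fun t : ℝ => f (AffineMap.lineMap (Γ.pos d) (Γ.pos w) t)) '' Set.Icc 0 1 := by
    apply intermediate_value_Icc' zero_le_one hcont.continuousOn
    simp only [AffineMap.lineMap_apply_zero, AffineMap.lineMap_apply_one]
    exact ⟨hfw.le, hfd.le⟩
  simp only at ht0
  set z : Plane := AffineMap.lineMap (Γ.pos d) (Γ.pos w) t
  have hz : z ∈ segment ℝ (Γ.pos d) (Γ.pos w) := by
    rw [segment_eq_image_lineMap]; exact ⟨t, ht, rfl⟩
  have hb := eq_barycentric hD z
  have hs := hsum z
  have h0 : 0 ≤ f z := ht0.ge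
  simp only [hf, le_min_iff] at h0
  obtain ⟨h1, h2, h3⟩ := h0
  simp only [hf] at ht0
  rcases min_eq_iff.1 ht0 with ⟨h, -⟩ | ⟨h, -⟩
  · rw [h] at hb hs
    refine Γ.notMem_segment_of_mem_segment hdw hpq hdp hdq hwp hwq hz
      ⟨_, _, h2, h3, by linarith, ?_⟩
    conv_rhs => rw [hb]
    module
  · rcases min_eq_iff.1 h with ⟨h, -⟩ | ⟨h, -⟩
    · rw [h] at hb hs
      refine Γ.notMem_segment_of_mem_segment hdw hcq hdc hdq hwc hwq hz
        ⟨_, _, h1, h3, by linarith, ?_⟩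
      conv_rhs => rw [hb]
      module
    · rw [h] at hb hs
      refine Γ.notMem_segment_of_mem_segment hdw hcp hdc hdp hwc hwp hz
        ⟨_, _, h1, h2, by linarith, ?_⟩
      conv_rhs => rw [hb]
      module

/-- If all vertices lie in a triangle with a vertex `c` as a corner, then `c` is not a convex
combination of other vertices. -/
lemma notMem_convexHull_of_corner {c p q : V} (hpq : G.Adj p q) (hcp : c ≠ p) (hcq : c ≠ q)
    (h : ∀ v, Γ.pos v ∈ triangle (Γ.pos c) (Γ.pos p) (Γ.pos q)) :
    Γ.pos c ∉ convexHull ℝ (Γ.pos '' {v | v ≠ c}) := by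
  let K : Set Plane := {x | ∃ α β γ : ℝ, 0 ≤ α ∧ 0 ≤ β ∧ 0 ≤ γ ∧ α + β + γ = 1 ∧ α < 1 ∧
    x = α • Γ.pos c + β • Γ.pos p + γ • Γ.pos q}
  have hK : Convex ℝ K := by
    rintro x ⟨α, β, γ, h1, h2, h3, h4, h5, rfl⟩ y ⟨α', β', γ', h1', h2', h3', h4', h5', rfl⟩
      s t hs ht hst
    refine ⟨s * α + t * α', s * β + t * β', s * γ + t * γ', by positivity, by positivity,
      by positivity, ?_, ?_, by module⟩
    · linear_combination s * h4 + t * h4' + hst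
    · rcases hs.eq_or_lt with rfl | hs
      · obtain rfl : t = 1 := by linarith
        simpa using h5'
      · nlinarith
  have hsub : Γ.pos '' {v | v ≠ c} ⊆ K := by
    rintro _ ⟨v, hv, rfl⟩
    obtain ⟨α, β, γ, h1, h2, h3, h4, h5⟩ := h v
    refine ⟨α, β, γ, h1, h2, h3, h4, lt_of_le_of_ne (by linarith) ?_, h5⟩
    rintro rfl
    obtain rfl : β = 0 := by linarith
    obtain rfl : γ = 0 := by linarith
    apply hv
    apply Γ.crossingFree.injective
    simpa using h5
  intro hc
  obtain ⟨α, β, γ, h1, h2, h3, h4, h5, h6⟩ := convexHull_min hsub hK hc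
  have h7 : Γ.pos c ∈ segment ℝ (Γ.pos p) (Γ.pos q) := by
    have h8 : 0 < 1 - α := by linarith
    refine ⟨β / (1 - α), γ / (1 - α), by positivity, by positivity, ?_, ?_⟩
    · field_simp; linarith
    · have : (1 - α) • Γ.pos c = β • Γ.pos p + γ • Γ.pos q := by
        rw [sub_smul, one_smul]
        nth_rewrite 1 [h6]
        module
      rw [div_eq_inv_mul, div_eq_inv_mul, mul_smul, mul_smul, ← smul_add, ← this,
        inv_smul_smul₀ h8.ne']
  rcases Γ.eq_or_eq_of_mem_segment hpq h7 with h | h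
  · exact hcp h
  · exact hcq h

lemma not_sbtw_of_notMem_convexHull {c u w : V}
    (hc : Γ.pos c ∉ convexHull ℝ (Γ.pos '' {v | v ≠ c})) :
    ¬ Sbtw ℝ (Γ.pos u) (Γ.pos c) (Γ.pos w) := by
  intro h
  apply hc
  have hu : u ≠ c := by rintro rfl; exact h.ne_left rfl
  have hw : w ≠ c := by rintro rfl; exact h.ne_right rfl
  exact (convex_convexHull ℝ _).segment_subset
    (subset_convexHull ℝ _ (Set.mem_image_of_mem Γ.pos hu))
    (subset_convexHull ℝ _ (Set.mem_image_of_mem Γ.pos hw)) (mem_segment_iff_wbtw.2 h.wbtw)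

lemma mem_convexHull_of_mem_triangle {d c p q : V} (hc : c ≠ d) (hp : p ≠ d) (hq : q ≠ d)
    (hd : Γ.pos d ∈ triangle (Γ.pos c) (Γ.pos p) (Γ.pos q)) :
    Γ.pos d ∈ convexHull ℝ (Γ.pos '' {v | v ≠ d}) := by
  obtain ⟨α, β, γ, h1, h2, h3, h4, h5⟩ := hd
  rw [h5]
  have := (convex_convexHull ℝ (Γ.pos '' {v | v ≠ d})).sum_mem (t := Finset.univ)
    (w := ![α, β, γ]) (z := ![Γ.pos c, Γ.pos p, Γ.pos q])
    (by intro i _; fin_cases i <;> simpa) (by simp [Fin.sum_univ_three, h4])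
    (by intro i _; fin_cases i <;> exact subset_convexHull ℝ _ ⟨_, by assumption, rfl⟩)
  simpa [Fin.sum_univ_three] using this

/-- Two different edges at `d` do not both continue the edge `ud`. -/
lemma eq_of_sbtw_of_sbtw {u d w w' : V} (hw : G.Adj d w) (hw' : G.Adj d w')
    (h : Sbtw ℝ (Γ.pos u) (Γ.pos d) (Γ.pos w)) (h' : Sbtw ℝ (Γ.pos u) (Γ.pos d) (Γ.pos w')) :
    w' = w := by
  obtain ⟨h1, r, hr, h2⟩ := sbtw_iff_left_ne_and_right_mem_image_Ioi.1 h
  obtain ⟨-, r', hr', h2'⟩ := sbtw_iff_left_ne_and_right_mem_image_Ioi.1 h'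
  simp only [Set.mem_Ioi] at hr hr'
  have hr0 : r - 1 ≠ 0 := by linarith
  refine Γ.eq_of_same_ray hw hw' (r := (r' - 1) / (r - 1))
    (div_nonneg (by linarith) (by linarith)) ?_
  rw [← h2, ← h2', AffineMap.lineMap_apply_module', AffineMap.lineMap_apply_module',
    AffineMap.lineMap_apply_module']
  have : r' = (r' - 1) / (r - 1) * (r - 1) + 1 := by field_simp; ring
  nth_rewrite 1 [this]
  module

end StraightLineDrawing

/-! ### The lower bound for `graphB` -/

lemma graphB_adj {n : ℕ} {x y : Fin n} : (graphB n).Adj x y ↔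
    x ≠ y ∧ ((x.val < 2 ∧ 2 ≤ y.val) ∨ y.val = x.val + 1 ∨ (y.val < 2 ∧ 2 ≤ x.val) ∨
      x.val = y.val + 1) := by
  simp only [graphB, SimpleGraph.fromRel_adj, or_assoc]

lemma graphB_adj_of_lt_two {n : ℕ} {x y : Fin n} (hx : x.val < 2) (hxy : y ≠ x) :
    (graphB n).Adj x y := by
  have := Fin.val_ne_of_ne hxy
  rw [graphB_adj]
  exact ⟨hxy.symm, by omega⟩

lemma graphB_adj_succ {n : ℕ} {x y : Fin n} (h : y.val = x.val + 1) : (graphB n).Adj x y := by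
  rw [graphB_adj]
  exact ⟨fun h' => by simp [h'] at h, Or.inr (Or.inl h)⟩

/-- The graph `graphB n` has (at least) `3 * n - 6` edges. -/
lemma exists_finset_edges_graphB (n : ℕ) (hn : 6 ≤ n) :
    ∃ F : Finset (Sym2 (Fin n)), (∀ e ∈ F, e ∈ (graphB n).edgeSet) ∧ F.card = 3 * n - 6 := by
  let a : Fin n := ⟨0, by omega⟩
  let b : Fin n := ⟨1, by omega⟩
  have ha : a.val = 0 := rfl
  have hb : b.val = 1 := rfl
  have hab : a ≠ b := by simp [a, b]
  let f : Fin (n - 3) → Sym2 (Fin n) := fun i => s(⟨i.val + 2, by omega⟩, ⟨i.val + 3, by omega⟩)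
  have hf : Function.Injective f := by
    intro i j hij
    simp only [f, Sym2.eq_iff, Fin.mk.injEq] at hij
    ext; omega
  have hmem : ∀ i (v : Fin n), v ∈ f i → 2 ≤ v.val := by
    intro i v hv
    rcases Sym2.mem_iff.1 hv with rfl | rfl <;> simp
  let E₀ : Finset (Sym2 (Fin n)) := (Finset.univ.erase a).image fun v => s(a, v)
  let E₁ : Finset (Sym2 (Fin n)) := ((Finset.univ.erase a).erase b).image fun v => s(b, v)
  let E₂ : Finset (Sym2 (Fin n)) := Finset.univ.image f
  have h₀ : E₀.card = n - 1 := by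
    rw [Finset.card_image_of_injective _ fun _ _ h => Sym2.congr_right.1 h,
      Finset.card_erase_of_mem (Finset.mem_univ _), Finset.card_fin]
  have h₁ : E₁.card = n - 2 := by
    rw [Finset.card_image_of_injective _ fun _ _ h => Sym2.congr_right.1 h,
      Finset.card_erase_of_mem (by simp [hab.symm]), Finset.card_erase_of_mem (Finset.mem_univ _),
      Finset.card_fin]
    omega
  have h₂ : E₂.card = n - 3 := by
    rw [Finset.card_image_of_injective _ hf, Finset.card_fin]
  have hd₀₁ : Disjoint E₀ E₁ := by
    simp only [E₀, E₁, Finset.disjoint_left, Finset.mem_image, Finset.mem_erase]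
    rintro _ ⟨v, -, rfl⟩ ⟨w, hw, h⟩
    rcases Sym2.mem_iff.1 (h ▸ Sym2.mem_mk_left a v) with h | h
    · exact hab h
    · exact hw.2.1 h.symm
  have hd₂ : Disjoint (E₀ ∪ E₁) E₂ := by
    simp only [E₀, E₁, E₂, Finset.disjoint_left, Finset.mem_union, Finset.mem_image]
    rintro _ (⟨v, -, rfl⟩ | ⟨v, -, rfl⟩) ⟨i, -, h⟩
    · have := hmem i a (h ▸ Sym2.mem_mk_left a v)
      omega
    · have := hmem i b (h ▸ Sym2.mem_mk_left b v)
      omega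
  refine ⟨E₀ ∪ E₁ ∪ E₂, ?_, ?_⟩
  · simp only [E₀, E₁, E₂, Finset.mem_union, Finset.mem_image, Finset.mem_erase]
    rintro _ ((⟨v, hv, rfl⟩ | ⟨v, hv, rfl⟩) | ⟨i, -, rfl⟩)
    · exact graphB_adj_of_lt_two (x := a) (by omega) hv.1
    · exact graphB_adj_of_lt_two (x := b) (by omega) hv.1
    · exact graphB_adj_succ rfl
  · rw [Finset.card_union_of_disjoint hd₂, Finset.card_union_of_disjoint hd₀₁, h₀, h₁, h₂]
    omega

lemma mul_pos_of_forall_succ {n : ℕ} (D : Fin n → ℝ) {x y : Fin n} (hx : D x ≠ 0)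
    (hxy : x.val ≤ y.val) (h : ∀ z z' : Fin n, x.val ≤ z.val → z'.val ≤ y.val →
      z'.val = z.val + 1 → 0 < D z * D z') : 0 < D x * D y := by
  obtain ⟨k, hk⟩ := Nat.exists_eq_add_of_le hxy
  induction k generalizing y with
  | zero =>
    obtain rfl : y = x := Fin.ext hk
    exact mul_self_pos.2 hx
  | succ k ih =>
    have h1 := ih (y := ⟨x.val + k, by omega⟩) (by simp)
      (fun z z' hz hz' hzz => h z z' hz (by simp only at hz'; omega) hzz) rfl
    have h2 := h ⟨x.val + k, by omega⟩ y (by simp) le_rfl (by simp only; omega)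
    nlinarith [mul_pos h1 h2, sq_nonneg (D ⟨x.val + k, by omega⟩)]

namespace StraightLineDrawing

/-- A straight passage through a vertex of the path leads along the path. -/
lemma val_eq_of_sbtw_of_two_le {n : ℕ} (Γ : StraightLineDrawing (graphB n)) {u v w : Fin n}
    (huv : (graphB n).Adj u v) (hvw : (graphB n).Adj v w)
    (h : Sbtw ℝ (Γ.pos u) (Γ.pos v) (Γ.pos w)) (hv : 2 ≤ v.val) :
    2 ≤ u.val ∧ 2 ≤ w.val ∧
      ((v.val = u.val + 1 ∧ w.val = v.val + 1) ∨ (v.val = w.val + 1 ∧ u.val = v.val + 1)) := by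
  have huw : u ≠ w := fun h' => h.left_ne_right (congrArg Γ.pos h')
  have hn := Γ.not_adj_of_sbtw h
  have hu : 2 ≤ u.val := by
    by_contra hu
    exact hn (graphB_adj_of_lt_two (by omega) huw.symm)
  have hw : 2 ≤ w.val := by
    by_contra hw
    exact hn (graphB_adj_of_lt_two (by omega) huw).symm
  rw [graphB_adj] at huv hvw
  have := Fin.val_ne_of_ne huw
  refine ⟨hu, hw, ?_⟩
  omega

lemma two_le_of_sbtw {n : ℕ} (Γ : StraightLineDrawing (graphB n)) {u v w : Fin n}
    (h : Sbtw ℝ (Γ.pos u) (Γ.pos v) (Γ.pos w)) : 2 ≤ u.val ∧ 2 ≤ w.val := by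
  have huw : u ≠ w := fun h' => h.left_ne_right (congrArg Γ.pos h')
  have hn := Γ.not_adj_of_sbtw h
  constructor
  · by_contra hu
    exact hn (graphB_adj_of_lt_two (by omega) huw.symm)
  · by_contra hw
    exact hn (graphB_adj_of_lt_two (by omega) huw).symm

lemma side_mul_side_neg_of_sbtw {V : Type*} {G : SimpleGraph V} (Γ : StraightLineDrawing G)
    {a b : Plane} {u v w : V} (h : Sbtw ℝ (Γ.pos u) (Γ.pos v) (Γ.pos w))
    (hv : side a b (Γ.pos v) = 0) (hu : side a b (Γ.pos u) ≠ 0) :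
    side a b (Γ.pos u) * side a b (Γ.pos w) < 0 := by
  obtain ⟨⟨t, ⟨ht0, ht1⟩, ht⟩, h1, h2⟩ := h
  rw [← ht, side_lineMap] at hv
  have ht0' : 0 < t := lt_of_le_of_ne ht0 (by rintro rfl; simp at ht; exact h1 ht.symm)
  have ht1' : t < 1 := lt_of_le_of_ne ht1 (by rintro rfl; simp at ht; exact h2 ht.symm)
  have : 0 < side a b (Γ.pos u) ^ 2 := by positivity
  by_contra hcon
  have h3 : (1 - t) * side a b (Γ.pos u) ^ 2
      + t * (side a b (Γ.pos u) * side a b (Γ.pos w)) = 0 := by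
    linear_combination side a b (Γ.pos u) * hv
  nlinarith [mul_pos (sub_pos.2 ht1') this, mul_nonneg ht0 (not_lt.1 hcon)]

/-- If consecutive vertices `p`, `q` of the path lie on different sides of the line through the
apices `c` and `d`, and `d` is inside the triangle `c p q`, then this triangle contains the whole
drawing. -/
lemma mem_triangle_graphB {n : ℕ} (Γ : StraightLineDrawing (graphB n)) {c d p q : Fin n}
    (hc : c.val < 2) (hd : d.val < 2) (hcd : c ≠ d) (hp : 2 ≤ p.val) (hq : q.val = p.val + 1)
    (h : Γ.pos d ∈ openTriangle (Γ.pos c) (Γ.pos p) (Γ.pos q)) (v : Fin n) :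
    Γ.pos v ∈ triangle (Γ.pos c) (Γ.pos p) (Γ.pos q) := by
  have hcp : p ≠ c := fun h => by rw [h] at hp; omega
  have hcq : q ≠ c := fun h => by rw [h] at hq; omega
  have hdp : p ≠ d := fun h => by rw [h] at hp; omega
  have hdq : q ≠ d := fun h => by rw [h] at hq; omega
  by_cases hv : v = d
  · rw [hv]; exact openTriangle_subset _ _ _ h
  · exact Γ.mem_triangle_of_adj (graphB_adj_of_lt_two hc hcp) (graphB_adj_of_lt_two hc hcq)
      (graphB_adj_succ hq) hcd.symm hdp.symm hdq.symm h (graphB_adj_of_lt_two hd hv)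

/-- The corners of a triangle as in `mem_triangle_graphB` are extreme points of the drawing. -/
lemma notMem_convexHull_graphB {n : ℕ} (Γ : StraightLineDrawing (graphB n)) {c d p q : Fin n}
    (hc : c.val < 2) (hd : d.val < 2) (hcd : c ≠ d) (hp : 2 ≤ p.val) (hq : q.val = p.val + 1)
    (h : Γ.pos d ∈ openTriangle (Γ.pos c) (Γ.pos p) (Γ.pos q)) {v : Fin n}
    (hv : v = c ∨ v = p ∨ v = q) : Γ.pos v ∉ convexHull ℝ (Γ.pos '' {w | w ≠ v}) := by
  have hcp : p ≠ c := fun h => by rw [h] at hp; omega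
  have hcq : q ≠ c := fun h => by rw [h] at hq; omega
  have hpq : p ≠ q := fun h => by rw [h] at hq; omega
  have hT := Γ.mem_triangle_graphB hc hd hcd hp hq h
  rcases hv with rfl | rfl | rfl
  · exact Γ.notMem_convexHull_of_corner (graphB_adj_succ hq) hcp.symm hcq.symm hT
  · exact Γ.notMem_convexHull_of_corner (graphB_adj_of_lt_two hc hcq) hcp hpq
      fun w => triangle_swap _ _ _ (hT w)
  · exact Γ.notMem_convexHull_of_corner (graphB_adj_of_lt_two hc hcp) hcq hpq.symm
      fun w => triangle_rotate _ _ _ (hT w)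

/-- The path crosses the line through the apices at most once. -/
lemma eq_of_mem_openTriangle {n : ℕ} (Γ : StraightLineDrawing (graphB n))
    {c d p q c' d' p' q' : Fin n} (hc : c.val < 2) (hd : d.val < 2) (hcd : c ≠ d)
    (hp : 2 ≤ p.val) (hq : q.val = p.val + 1) (hc' : c'.val < 2) (hd' : d'.val < 2)
    (hcd' : c' ≠ d') (hp' : 2 ≤ p'.val) (hq' : q'.val = p'.val + 1)
    (h : Γ.pos d ∈ openTriangle (Γ.pos c) (Γ.pos p) (Γ.pos q))
    (h' : Γ.pos d' ∈ openTriangle (Γ.pos c') (Γ.pos p') (Γ.pos q')) : p = p' := by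
  have key : ∀ v, (v = p' ∨ v = q') → v = p ∨ v = q := by
    intro v hv
    by_contra hcon
    push Not at hcon
    refine Γ.notMem_convexHull_graphB hc' hd' hcd' hp' hq' h' (Or.inr hv)
      (Γ.mem_convexHull_of_mem_triangle ?_ hcon.1.symm hcon.2.symm
        (Γ.mem_triangle_graphB hc hd hcd hp hq h v))
    rintro rfl
    rcases hv with rfl | rfl <;> omega
  have h1 := key p' (Or.inl rfl)
  have h2 := key q' (Or.inr rfl)
  simp only [Fin.ext_iff] at h1 h2 ⊢
  omega

/-- The straight passages of a drawing of `graphB n` can be represented by a set `P` of at most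
`n + n / 2 - 7` elements. -/
lemma exists_passages (n : ℕ) (hn : 6 ≤ n) (Γ : StraightLineDrawing (graphB n)) :
    ∃ P : Finset (Fin n × Fin n × Fin n),
      (∀ u v w, (graphB n).Adj u v → (graphB n).Adj v w →
        Sbtw ℝ (Γ.pos u) (Γ.pos v) (Γ.pos w) → (u, v, w) ∈ P ∨ (w, v, u) ∈ P) ∧
      P.card + 7 ≤ n + n / 2 := by
  classical
  let a : Fin n := ⟨0, by omega⟩
  let b : Fin n := ⟨1, by omega⟩
  let D : Fin n → ℝ := fun v => side (Γ.pos a) (Γ.pos b) (Γ.pos v)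
  have hab : a ≠ b := by simp [a, b]
  have hD0 : ∀ v : Fin n, 2 ≤ v.val → D v ≠ 0 := by
    intro v hv
    have h1 : v ≠ a := by rintro rfl; simp [a] at hv
    have h2 : v ≠ b := by rintro rfl; simp [b] at hv
    exact Γ.side_ne_zero (graphB_adj_of_lt_two (by simp [a]) hab.symm)
      (graphB_adj_of_lt_two (by simp [b]) h2) (graphB_adj_of_lt_two (by simp [a]) h1)
  have hDapex : ∀ v : Fin n, v.val < 2 → D v = 0 := by
    intro v hv
    obtain h | h : v = a ∨ v = b := by simp only [Fin.ext_iff, a, b]; omega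
    · simp [D, h]
    · simp [D, h]
  have hDsbtw : ∀ u v w : Fin n, v.val < 2 → Sbtw ℝ (Γ.pos u) (Γ.pos v) (Γ.pos w) →
      D u * D w < 0 := fun u v w hv h =>
    Γ.side_mul_side_neg_of_sbtw h (hDapex v hv) (hD0 u (Γ.two_le_of_sbtw h).1)
  -- The passages through vertices of the path; the other passages are through apices.
  let P₂ : (Fin n → Prop) → Finset (Fin n × Fin n × Fin n) := fun Q => Finset.univ.filter fun p =>
    2 ≤ p.1.val ∧ p.2.1.val = p.1.val + 1 ∧ p.2.2.val = p.2.1.val + 1 ∧ Q p.2.1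
  have hP₂ : ∀ Q : Fin n → Prop, ∀ T : Finset ℕ,
      (∀ v : Fin n, 3 ≤ v.val → v.val + 1 < n → Q v → v.val ∈ T) → (P₂ Q).card ≤ T.card := by
    intro Q T hT
    refine Finset.card_le_card_of_injOn (fun p => p.2.1.val) ?_ ?_
    · rintro ⟨u, v, w⟩ hp
      simp only [P₂, Finset.coe_filter, Finset.mem_univ, true_and, Set.mem_ofPred_eq] at hp
      exact hT v (by omega) (by omega) hp.2.2.2
    · rintro ⟨u, v, w⟩ hp ⟨u', v', w'⟩ hp' hvv
      simp only [P₂, Finset.coe_filter, Finset.mem_univ, true_and, Set.mem_ofPred_eq] at hp hp' hvv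
      simp only [Prod.mk.injEq, Fin.ext_iff]
      omega
  by_cases hcross : ∃ p q : Fin n, 2 ≤ p.val ∧ q.val = p.val + 1 ∧ D p * D q < 0
  swap
  · -- All vertices of the path lie on one side of the line through the apices.
    push Not at hcross
    have hsame : ∀ u : Fin n, 2 ≤ u.val → 0 < D ⟨2, by omega⟩ * D u := by
      intro u hu
      refine mul_pos_of_forall_succ D (hD0 _ le_rfl) hu fun z z' hz _ hzz =>
        lt_of_le_of_ne (hcross z z' hz hzz) (mul_ne_zero (hD0 z hz) (hD0 z' ?_)).symm
      simp only at hz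
      omega
    refine ⟨P₂ fun _ => True, ?_, ?_⟩
    · intro u v w huv hvw h
      by_cases hv : 2 ≤ v.val
      · obtain ⟨hu, hw, h' | h'⟩ := Γ.val_eq_of_sbtw_of_two_le huv hvw h hv
        · left; simp [P₂]; omega
        · right; simp [P₂]; omega
      · exfalso
        have h1 := hDsbtw u v w (by omega) h
        have h2 := hsame u (Γ.two_le_of_sbtw h).1
        have h3 := hsame w (Γ.two_le_of_sbtw h).2
        nlinarith [mul_pos h2 h3, sq_nonneg (D ⟨2, by omega⟩)]
    · have := hP₂ (fun _ => True) (Finset.Icc 3 (n - 2))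
        (fun v h1 h2 _ => Finset.mem_Icc.2 ⟨h1, by omega⟩)
      rw [Nat.card_Icc] at this
      omega
  obtain ⟨p, q, hp, hq, hpq⟩ := hcross
  have hcenter : ∀ p q : Fin n, 2 ≤ p.val → q.val = p.val + 1 → D p * D q < 0 →
      ∃ c d : Fin n, c.val < 2 ∧ d.val < 2 ∧ c ≠ d ∧
        Γ.pos d ∈ openTriangle (Γ.pos c) (Γ.pos p) (Γ.pos q) := by
    intro p q hp hq hpq
    have hpa : p ≠ a := fun h => by rw [h] at hp; simp [a] at hp
    have hpb : p ≠ b := fun h => by rw [h] at hp; simp [b] at hp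
    have hqa : q ≠ a := fun h => by rw [h] at hq; simp [a] at hq
    have hqb : q ≠ b := fun h => by rw [h] at hq; simp [b] at hq; omega
    have ha : a.val < 2 := by simp [a]
    have hb : b.val < 2 := by simp [b]
    rcases Γ.mem_openTriangle_or (graphB_adj_of_lt_two ha hab.symm) (graphB_adj_of_lt_two ha hpa)
      (graphB_adj_of_lt_two ha hqa) (graphB_adj_of_lt_two hb hpb) (graphB_adj_of_lt_two hb hqb)
      (graphB_adj_succ hq) hpq with h | h
    · exact ⟨a, b, ha, hb, hab, h⟩
    · exact ⟨b, a, hb, ha, hab.symm, h⟩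
  obtain ⟨c, d, hc, hd, hcd, h⟩ := hcenter p q hp hq hpq
  have hext : ∀ v, (v = c ∨ v = p ∨ v = q) → ∀ u w, ¬ Sbtw ℝ (Γ.pos u) (Γ.pos v) (Γ.pos w) :=
    fun v hv u w => Γ.not_sbtw_of_notMem_convexHull (Γ.notMem_convexHull_graphB hc hd hcd hp hq h hv)
  have hstep : ∀ x y : Fin n, 2 ≤ x.val → y.val = x.val + 1 → x ≠ p → 0 < D x * D y := by
    intro x y hx hy hxp
    rcases lt_trichotomy (D x * D y) 0 with h0 | h0 | h0
    · obtain ⟨c', d', hc', hd', hcd', h'⟩ := hcenter x y hx hy h0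
      exact absurd (Γ.eq_of_mem_openTriangle hc hd hcd hp hq hc' hd' hcd' hx hy h h').symm hxp
    · rcases mul_eq_zero.1 h0 with h0 | h0
      · exact absurd h0 (hD0 x hx)
      · exact absurd h0 (hD0 y (by omega))
    · exact h0
  have hconst : ∀ x y : Fin n, 2 ≤ x.val → x.val ≤ y.val → (y.val ≤ p.val ∨ p.val < x.val) →
      0 < D x * D y := by
    intro x y hx hxy hp'
    refine mul_pos_of_forall_succ D (hD0 x hx) hxy fun z z' hz hz' hzz =>
      hstep z z' (by omega) hzz ?_
    rintro rfl
    omega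
  -- A passage through `d` connects the two parts of the path.
  let P₁ : Finset (Fin n × Fin n × Fin n) := Finset.univ.filter fun r =>
    2 ≤ r.1.val ∧ r.1.val ≤ p.val ∧ p.val < r.2.2.val ∧ r.2.1 = d ∧
      Sbtw ℝ (Γ.pos r.1) (Γ.pos r.2.1) (Γ.pos r.2.2)
  have hadj : ∀ v : Fin n, 2 ≤ v.val → (graphB n).Adj d v := fun v hv =>
    graphB_adj_of_lt_two hd (fun h => by rw [h] at hv; omega)
  have hP₁l : P₁.card ≤ (Finset.Icc 2 p.val).card := by
    refine Finset.card_le_card_of_injOn (fun r => r.1.val) ?_ ?_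
    · rintro ⟨u, v, w⟩ hr
      simp only [P₁, Finset.coe_filter, Finset.mem_univ, true_and, Set.mem_ofPred_eq] at hr
      simp only [Finset.coe_Icc, Set.mem_Icc]
      omega
    · rintro ⟨u, v, w⟩ hr ⟨u', v', w'⟩ hr' huu
      simp only [P₁, Finset.coe_filter, Finset.mem_univ, true_and, Set.mem_ofPred_eq] at hr hr' huu
      obtain ⟨h1, h2, h3, rfl, h4⟩ := hr
      obtain ⟨h1', h2', h3', rfl, h4'⟩ := hr'
      obtain rfl : u = u' := Fin.ext huu
      rw [Γ.eq_of_sbtw_of_sbtw (hadj w' (by omega)) (hadj w (by omega)) h4' h4]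
  have hP₁r : P₁.card ≤ (Finset.Icc (p.val + 1) (n - 1)).card := by
    refine Finset.card_le_card_of_injOn (fun r => r.2.2.val) ?_ ?_
    · rintro ⟨u, v, w⟩ hr
      simp only [P₁, Finset.coe_filter, Finset.mem_univ, true_and, Set.mem_ofPred_eq] at hr
      simp only [Finset.coe_Icc, Set.mem_Icc]
      omega
    · rintro ⟨u, v, w⟩ hr ⟨u', v', w'⟩ hr' huu
      simp only [P₁, Finset.coe_filter, Finset.mem_univ, true_and, Set.mem_ofPred_eq] at hr hr' huu
      obtain ⟨h1, h2, h3, rfl, h4⟩ := hr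
      obtain ⟨h1', h2', h3', rfl, h4'⟩ := hr'
      obtain rfl : w = w' := Fin.ext huu
      rw [Γ.eq_of_sbtw_of_sbtw (hadj u' (by omega)) (hadj u (by omega)) h4'.symm h4.symm]
  refine ⟨P₁ ∪ P₂ fun v => v ≠ p ∧ v ≠ q, ?_, ?_⟩
  · intro u v w huv hvw hb
    have hvp : v ≠ p := fun h' => hext v (Or.inr (Or.inl h')) u w hb
    have hvq : v ≠ q := fun h' => hext v (Or.inr (Or.inr h')) u w hb
    by_cases hv : 2 ≤ v.val
    · obtain ⟨hu, hw, h' | h'⟩ := Γ.val_eq_of_sbtw_of_two_le huv hvw hb hv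
      · left; simp [P₂, hvp, hvq]; omega
      · right; simp [P₂, hvp, hvq]; omega
    · have hvd : v = d := by
        have hvc : v ≠ c := fun h' => hext v (Or.inl h') u w hb
        simp only [ne_eq, Fin.ext_iff] at hvc hcd ⊢
        omega
      obtain ⟨hu, hw⟩ := Γ.two_le_of_sbtw hb
      have hneg := hDsbtw u v w (by omega) hb
      have h1 : ¬ (w.val ≤ p.val ∧ u.val ≤ p.val) := by
        rintro ⟨h1, h2⟩
        rcases le_total u.val w.val with h3 | h3
        · exact hneg.not_gt (hconst u w hu h3 (Or.inl h1))
        · exact hneg.not_gt (mul_comm (D w) (D u) ▸ hconst w u hw h3 (Or.inl h2))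
      have h2 : ¬ (p.val < w.val ∧ p.val < u.val) := by
        rintro ⟨h1, h2⟩
        rcases le_total u.val w.val with h3 | h3
        · exact hneg.not_gt (hconst u w hu h3 (Or.inr h2))
        · exact hneg.not_gt (mul_comm (D w) (D u) ▸ hconst w u hw h3 (Or.inr h1))
      rcases le_or_gt u.val p.val with h3 | h3
      · left
        refine Finset.mem_union_left _ (Finset.mem_filter.2 ⟨Finset.mem_univ _, hu, h3, ?_, hvd, hb⟩)
        simp only; omega
      · right
        refine Finset.mem_union_left _
          (Finset.mem_filter.2 ⟨Finset.mem_univ _, hw, ?_, h3, hvd, hb.symm⟩)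
        simp only; omega
  · have h1 := Finset.card_union_le P₁ (P₂ fun v => v ≠ p ∧ v ≠ q)
    rw [Nat.card_Icc] at hP₁l hP₁r
    have hqn := q.isLt
    have h2 := hP₂ (fun v => v ≠ p ∧ v ≠ q) (((Finset.Icc 3 (n - 2)).erase p.val).erase q.val) (by
      intro v h1 h2 h3
      simp only [Finset.mem_erase, Finset.mem_Icc]
      exact ⟨Fin.val_ne_of_ne h3.2, Fin.val_ne_of_ne h3.1, h1, by omega⟩)
    rw [Finset.card_erase_eq_ite, Finset.card_erase_eq_ite, Nat.card_Icc] at h2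
    simp only [Finset.mem_erase, Finset.mem_Icc] at h2
    split_ifs at h2 <;> omega

end StraightLineDrawing

theorem le_seg_graphB (n : ℕ) (hn : 6 ≤ n) :
    ((n + (n + 1) / 2 + 1 : ℕ) : ℕ∞) ≤ seg (graphB n) := by
  refine le_iInf fun Γ => ?_
  obtain ⟨F, hF, hFc⟩ := exists_finset_edges_graphB n hn
  obtain ⟨P, hP, hPc⟩ := Γ.exists_passages n hn
  have h := Γ.card_le_encard_segments_add F hF P hP
  cases hs : Γ.segments.encard with
  | top => exact le_top
  | coe k =>
    rw [hs, hFc] at h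
    have h' : 3 * n - 6 ≤ k + P.card := by exact_mod_cast h
    have : n + (n + 1) / 2 + 1 ≤ k := by omega
    exact_mod_cast this

/-! ### A drawing of `graphB` with few segments -/

lemma sbtw_of_lt_of_lt {x y z : ℝ} (hxy : x < y) (hyz : y < z) : Sbtw ℝ x y z := by
  refine ⟨⟨(y - x) / (z - x), ⟨div_nonneg (by linarith) (by linarith),
    (div_le_one (by linarith)).2 (by linarith)⟩, ?_⟩, hxy.ne', hyz.ne⟩
  have : z - x ≠ 0 := by linarith
  rw [AffineMap.lineMap_apply_ring']
  field_simp
  ring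

/-- The horizontal direction, left or right of the line through the apices, in which the path vertex
with index `i` is placed. -/
def sideSign (k i : ℕ) : ℝ := if i ≤ k + 1 then -1 else 1

/-- The inverse of the horizontal distance of the path vertex with index `τ` from the line through
the apices, on the side of the vertex with index `i`. It is stated for real `τ`: the values for
`i ≤ τ ≤ i + 1` give the points of the edge between the path vertices with indices `i` and
`i + 1`. -/
def invDist (k i : ℕ) (τ : ℝ) : ℝ := if i ≤ k + 1 then k + 2 - τ else τ - (k + 1)

/-- The height at which the apex with index `c` (`0` or `1`) is placed. -/
def apexHeight (c : ℕ) : ℝ := if c = 0 then 3 else 0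

/-- The placement of the vertices of `graphB n`: with `k = (n - 1) / 2`, the apices are at `(0, 3)`
and `(0, 0)`, the first `k` vertices of the path are on the line `y = 2 + (k + 1) x` at
`x = -1 / k, …, -1 / 2, -1`, and the others are on the line `y = 2 - (k + 1) x` at
`x = 1, 1 / 2, 1 / 3, …`. -/
noncomputable def posB (n : ℕ) (v : Fin n) : Plane :=
  let k := (n - 1) / 2
  if v.val < 2 then !₂[0, apexHeight v.val]
  else !₂[sideSign k v.val * (invDist k v.val v.val)⁻¹, 2 - (k + 1) * (invDist k v.val v.val)⁻¹]

lemma one_le_invDist {k i : ℕ} : 1 ≤ invDist k i i := by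
  unfold invDist
  split_ifs with h
  · have : (i : ℝ) ≤ k + 1 := by exact_mod_cast h
    linarith
  · have : (k : ℝ) + 1 + 1 ≤ i := by exact_mod_cast not_le.1 h
    linarith

lemma invDist_congr {k i j : ℕ} (h : i ≤ k + 1 ↔ j ≤ k + 1) : invDist k i = invDist k j := by
  funext τ
  simp [invDist, h]

lemma invDist_injective (k i : ℕ) : Function.Injective (invDist k i) := by
  intro τ τ' h
  unfold invDist at h
  split_ifs at h <;> linarith

lemma sideSign_congr {k i j : ℕ} (h : i ≤ k + 1 ↔ j ≤ k + 1) : sideSign k i = sideSign k j := by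
  simp [sideSign, h]

lemma sideSign_ne_zero (k i : ℕ) : sideSign k i ≠ 0 := by
  unfold sideSign; split_ifs <;> norm_num

lemma sideSign_mul_eq {k i j : ℕ} {w w' : ℝ} (hw : 0 ≤ w) (hw' : 0 ≤ w')
    (h : sideSign k i * w = sideSign k j * w') :
    ((i ≤ k + 1 ↔ j ≤ k + 1) ∧ w = w') ∨ (w = 0 ∧ w' = 0) := by
  unfold sideSign at h
  split_ifs at h with h1 h2 h2
  · left; exact ⟨by tauto, by linarith⟩
  · right; constructor <;> linarith
  · right; constructor <;> linarith
  · left; exact ⟨by tauto, by linarith⟩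

section Points

variable {n : ℕ}

lemma posB_apex {c : Fin n} (hc : c.val < 2) : posB n c = !₂[0, apexHeight c.val] := by
  simp [posB, hc]

lemma posB_path {v : Fin n} (hv : 2 ≤ v.val) {k : ℕ} (hk : k = (n - 1) / 2) :
    posB n v = !₂[sideSign k v.val * (invDist k v.val v.val)⁻¹,
      2 - (k + 1) * (invDist k v.val v.val)⁻¹] := by
  subst hk
  simp [posB, not_lt.2 hv]

lemma eq_posB_apex {c : Fin n} (hc : c.val < 2) {z : Plane} (h0 : z 0 = 0)
    (h1 : z 1 = apexHeight c.val) : z = posB n c := by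
  rw [posB_apex hc]
  ext i; fin_cases i
  · simpa using h0
  · simpa using h1

lemma eq_posB_path {v : Fin n} (hv : 2 ≤ v.val) {k : ℕ} (hk : k = (n - 1) / 2) {z : Plane} {w : ℝ}
    (h0 : z 0 = sideSign k v.val * w) (h1 : z 1 = 2 - (k + 1) * w)
    (hw : invDist k v.val v.val * w = 1) : z = posB n v := by
  rw [posB_path hv hk, ← eq_inv_of_mul_eq_one_right hw]
  ext i; fin_cases i
  · simpa using h0
  · simpa using h1

/-- The points of an edge between an apex and a vertex of the path. -/
lemma exists_of_mem_segment_apex {c v : Fin n} (hc : c.val < 2) (hv : 2 ≤ v.val) {k : ℕ}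
    (hk : k = (n - 1) / 2) {z : Plane} (hz : z ∈ segment ℝ (posB n c) (posB n v)) :
    ∃ w, 0 ≤ w ∧ invDist k v.val v.val * w ≤ 1 ∧ z 0 = sideSign k v.val * w ∧
      z 1 = apexHeight c.val + (2 - apexHeight c.val) * (invDist k v.val v.val * w)
        - (k + 1) * w := by
  rw [segment_eq_image_lineMap, posB_apex hc, posB_path hv hk] at hz
  obtain ⟨t, ⟨ht0, ht1⟩, rfl⟩ := hz
  have hR := one_le_invDist (k := k) (i := v.val)
  have hR' : invDist k v.val v.val ≠ 0 := by linarith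
  refine ⟨t * (invDist k v.val v.val)⁻¹, by positivity, ?_, ?_, ?_⟩
  · rw [mul_comm, mul_assoc, inv_mul_cancel₀ hR', mul_one]
    exact ht1
  · simp [AffineMap.lineMap_apply_module]
    ring
  · simp [AffineMap.lineMap_apply_module]
    field_simp
    ring

/-- The points of an edge of the path that does not cross the line through the apices. -/
lemma exists_of_mem_segment_path {u v : Fin n} (hu : 2 ≤ u.val) (hv : v.val = u.val + 1) {k : ℕ}
    (hk : k = (n - 1) / 2) (huk : u.val ≠ k + 1) {z : Plane}
    (hz : z ∈ segment ℝ (posB n u) (posB n v)) :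
    ∃ w, 0 < w ∧ z 0 = sideSign k u.val * w ∧ z 1 = 2 - (k + 1) * w ∧
      ∃ τ : ℝ, u.val ≤ τ ∧ τ ≤ v.val ∧ invDist k u.val τ * w = 1 := by
  have hside : u.val ≤ k + 1 ↔ v.val ≤ k + 1 := by omega
  rw [segment_eq_image_lineMap, posB_path hu hk, posB_path (by omega) hk] at hz
  obtain ⟨t, ⟨ht0, ht1⟩, rfl⟩ := hz
  have hR := one_le_invDist (k := k) (i := u.val)
  have hR' := one_le_invDist (k := k) (i := v.val)
  set r := invDist k u.val u.val with hr
  set r' := invDist k v.val v.val with hr'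
  have hp : (0 : ℝ) < r⁻¹ := by positivity
  have hp' : (0 : ℝ) < r'⁻¹ := by positivity
  have hw : 0 < (1 - t) * r⁻¹ + t * r'⁻¹ := by
    rcases ht0.eq_or_lt with rfl | ht0
    · simpa using hp
    · nlinarith [mul_pos ht0 hp', mul_nonneg (sub_nonneg.2 ht1) hp.le]
  have hvu : (v.val : ℝ) = u.val + 1 := by exact_mod_cast hv
  have hrw : r * r⁻¹ = 1 := mul_inv_cancel₀ (by linarith)
  have hrw' : r' * r'⁻¹ = 1 := mul_inv_cancel₀ (by linarith)
  refine ⟨(1 - t) * r⁻¹ + t * r'⁻¹, hw, ?_, ?_, ?_⟩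
  · simp [AffineMap.lineMap_apply_module, sideSign_congr hside]
    ring
  · simp [AffineMap.lineMap_apply_module]
    ring
  · by_cases hl : u.val ≤ k + 1
    · have e1 : r' = r - 1 := by
        simp only [hr, hr', invDist, hl, hside.1 hl, if_true, hvu]; ring
      have e0 : (u.val : ℝ) = k + 2 - r := by simp only [hr, invDist, hl, if_true]; ring
      refine ⟨k + 2 - ((1 - t) * r⁻¹ + t * r'⁻¹)⁻¹, ?_, ?_, ?_⟩
      · rw [e0, sub_le_sub_iff_left]
        apply inv_le_of_inv_le₀ (by linarith)
        have : r⁻¹ ≤ r'⁻¹ := inv_anti₀ (by linarith) (by linarith)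
        nlinarith
      · have : (v.val : ℝ) = k + 2 - r' := by rw [hvu, e0, e1]; ring
        rw [this, sub_le_sub_iff_left]
        apply le_inv_of_le_inv₀ hw
        have : r⁻¹ ≤ r'⁻¹ := inv_anti₀ (by linarith) (by linarith)
        nlinarith
      · simp only [invDist, hl, if_true]
        rw [sub_sub_cancel, inv_mul_cancel₀ hw.ne']
    · have hl' : ¬ v.val ≤ k + 1 := fun h => hl (hside.2 h)
      have e1 : r' = r + 1 := by
        simp only [hr, hr', invDist, hl, hl', if_false, hvu]; ring
      have e0 : (u.val : ℝ) = r + (k + 1) := by simp only [hr, invDist, hl, if_false]; ring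
      have : r'⁻¹ ≤ r⁻¹ := inv_anti₀ (by linarith) (by linarith)
      refine ⟨((1 - t) * r⁻¹ + t * r'⁻¹)⁻¹ + (k + 1), ?_, ?_, ?_⟩
      · rw [e0, add_le_add_iff_right]
        apply le_inv_of_le_inv₀ hw
        nlinarith
      · have : (v.val : ℝ) = r' + (k + 1) := by rw [hvu, e0, e1]; ring
        rw [this, add_le_add_iff_right]
        apply inv_le_of_inv_le₀ (by linarith)
        nlinarith
      · simp only [invDist, hl, if_false]
        rw [add_sub_cancel_right, inv_mul_cancel₀ hw.ne']

/-- The points of the edge of the path that crosses the line through the apices. -/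
lemma apply_one_of_mem_segment_bottom {u v : Fin n} (hu : 2 ≤ u.val) (hv : v.val = u.val + 1)
    {k : ℕ} (hk : k = (n - 1) / 2) (huk : u.val = k + 1) {z : Plane}
    (hz : z ∈ segment ℝ (posB n u) (posB n v)) : z 1 = 1 - k := by
  rw [segment_eq_image_lineMap, posB_path hu hk, posB_path (by omega) hk] at hz
  obtain ⟨t, -, rfl⟩ := hz
  have h1 : invDist k u.val u.val = 1 := by simp [invDist, huk]; ring
  have h2 : invDist k v.val v.val = 1 := by simp [invDist, hv, huk]
  simp [AffineMap.lineMap_apply_module, h1, h2]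
  ring

lemma of_mem_segment_apices {c d : Fin n} (hc : c.val = 0) (hd : d.val = 1) {z : Plane}
    (hz : z ∈ segment ℝ (posB n c) (posB n d)) : z 0 = 0 ∧ 0 ≤ z 1 := by
  rw [segment_eq_image_lineMap, posB_apex (by omega), posB_apex (by omega)] at hz
  obtain ⟨t, ⟨ht0, ht1⟩, rfl⟩ := hz
  simp [AffineMap.lineMap_apply_module, hc, hd, apexHeight]
  linarith

lemma invDist_eq_one_iff {k i : ℕ} : invDist k i i = 1 ↔ i = k + 1 ∨ i = k + 2 := by
  unfold invDist
  split_ifs with h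
  · constructor
    · intro h'
      left
      have : (i : ℝ) = (k + 1 : ℕ) := by push_cast; linarith
      exact_mod_cast this
    · intro h'
      obtain rfl : i = k + 1 := by omega
      push_cast; ring
  · constructor
    · intro h'
      right
      have : (i : ℝ) = (k + 2 : ℕ) := by push_cast; linarith
      exact_mod_cast this
    · intro h'
      obtain rfl : i = k + 2 := by omega
      push_cast; ring

lemma posB_injective (n : ℕ) : Function.Injective (posB n) := by
  intro u v huv
  set k := (n - 1) / 2 with hk
  have hpos : ∀ i : ℕ, 0 < (invDist k i i)⁻¹ := fun i =>
    inv_pos.2 (by linarith [one_le_invDist (k := k) (i := i)])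
  have h0 : posB n u 0 = posB n v 0 := by rw [huv]
  have h1 : posB n u 1 = posB n v 1 := by rw [huv]
  ext
  by_cases hu : u.val < 2 <;> by_cases hv : v.val < 2
  · rw [posB_apex hu, posB_apex hv] at h1
    simp [apexHeight] at h1
    split_ifs at h1 <;> first | omega | norm_num at h1
  · rw [posB_apex hu, posB_path (not_lt.1 hv) hk] at h0
    simp at h0
    rcases h0 with h0 | h0
    · exact absurd h0 (sideSign_ne_zero _ _)
    · exact absurd (hpos v.val) (by simp [h0])
  · rw [posB_apex hv, posB_path (not_lt.1 hu) hk] at h0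
    simp at h0
    rcases h0 with h0 | h0
    · exact absurd h0 (sideSign_ne_zero _ _)
    · exact absurd (hpos u.val) (by simp [h0])
  · rw [posB_path (not_lt.1 hu) hk, posB_path (not_lt.1 hv) hk] at h0
    simp at h0
    rcases sideSign_mul_eq (hpos _).le (hpos _).le h0 with ⟨h, h'⟩ | ⟨h, -⟩
    · rw [inv_inj, invDist_congr h] at h'
      exact_mod_cast invDist_injective _ _ h'
    · exact absurd h (hpos _).ne'

end Points

/-- The four kinds of edges of `graphB n`: the edge between the apices, the edges between an apex
and the path, and the edges of the path, one of which crosses the line through the apices in the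
drawing `posB n`. -/
lemma edge_cases {n : ℕ} (hn : 6 ≤ n) (k : ℕ) {e : Sym2 (Fin n)} (he : e ∈ (graphB n).edgeSet) :
    (e = s(⟨0, by omega⟩, ⟨1, by omega⟩)) ∨
    (∃ c v : Fin n, c.val < 2 ∧ 2 ≤ v.val ∧ e = s(c, v)) ∨
    (∃ u v : Fin n, 2 ≤ u.val ∧ v.val = u.val + 1 ∧ u.val ≠ k + 1 ∧ e = s(u, v)) ∨
    (∃ u v : Fin n, 2 ≤ u.val ∧ v.val = u.val + 1 ∧ u.val = k + 1 ∧ e = s(u, v)) := by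
  have key : ∀ x y : Fin n, ((x.val < 2 ∧ 2 ≤ y.val) ∨ y.val = x.val + 1) →
      (s(x, y) = s((⟨0, by omega⟩ : Fin n), (⟨1, by omega⟩ : Fin n))) ∨
      (∃ c v : Fin n, c.val < 2 ∧ 2 ≤ v.val ∧ s(x, y) = s(c, v)) ∨
      (∃ u v : Fin n, 2 ≤ u.val ∧ v.val = u.val + 1 ∧ u.val ≠ k + 1 ∧ s(x, y) = s(u, v)) ∨
      (∃ u v : Fin n, 2 ≤ u.val ∧ v.val = u.val + 1 ∧ u.val = k + 1 ∧ s(x, y) = s(u, v)) := by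
    intro x y h
    by_cases hx : x.val < 2
    · by_cases hy : 2 ≤ y.val
      · exact Or.inr (Or.inl ⟨x, y, hx, hy, rfl⟩)
      · left
        congr 2 <;> ext <;> simp only <;> omega
    · by_cases hxk : x.val = k + 1
      · exact Or.inr (Or.inr (Or.inr ⟨x, y, by omega, by omega, hxk, rfl⟩))
      · exact Or.inr (Or.inr (Or.inl ⟨x, y, by omega, by omega, hxk, rfl⟩))
  induction e with
  | _ x y =>
    rcases (graphB_adj.1 he).2 with h | h | h | h
    · exact key x y (Or.inl h)
    · exact key x y (Or.inr h)
    · rw [Sym2.eq_swap]; exact key y x (Or.inl h)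
    · rw [Sym2.eq_swap]; exact key y x (Or.inr h)

/-- Two edges of the drawing `posB n` meet at most in a common end. With `w = |x|`, the path vertex at
distance `1 / r` from the line through the apices satisfies `y + (k + 1) * w = 2`, as do the points of
the edges of the path that do not cross this line; on the edge to the apex at height `h` this
expression is `h + (2 - h) * (r * w)`. So it is above `2` on the edges from the upper apex and below
`2` on the edges from the lower one, except at the path. -/
lemma posB_edge {n : ℕ} (hn : 6 ≤ n) {e f : Sym2 (Fin n)} (he : e ∈ (graphB n).edgeSet)
    (hf : f ∈ (graphB n).edgeSet) (hef : e ≠ f) {z : Plane} (hze : z ∈ edgeSegment (posB n) e)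
    (hzf : z ∈ edgeSegment (posB n) f) : ∃ w, w ∈ e ∧ w ∈ f ∧ z = posB n w := by
  obtain ⟨k, hk⟩ : ∃ k, k = (n - 1) / 2 := ⟨_, rfl⟩
  have hk2 : (2 : ℝ) ≤ k := by exact_mod_cast (by omega : 2 ≤ k)
  have hR : ∀ i : ℕ, 1 ≤ invDist k i i := fun i => one_le_invDist
  have hswap : ∀ {e f : Sym2 (Fin n)}, (∃ w, w ∈ e ∧ w ∈ f ∧ z = posB n w) →
      ∃ w, w ∈ f ∧ w ∈ e ∧ z = posB n w := by
    rintro e f ⟨w, h1, h2, h3⟩; exact ⟨w, h2, h1, h3⟩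
  -- the edge between the apices and an edge between an apex and the path
  have h12 : ∀ a b c v : Fin n, a.val = 0 → b.val = 1 → c.val < 2 → 2 ≤ v.val →
      z ∈ segment ℝ (posB n a) (posB n b) → z ∈ segment ℝ (posB n c) (posB n v) →
      ∃ w, w ∈ s(a, b) ∧ w ∈ s(c, v) ∧ z = posB n w := by
    intro a b c v ha hb hc hv h h'
    obtain ⟨h0, -⟩ := of_mem_segment_apices ha hb h
    obtain ⟨w, hw, -, hz0, hz1⟩ := exists_of_mem_segment_apex hc hv hk h'
    have hw0 : w = 0 := by
      rw [h0] at hz0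
      exact (mul_eq_zero.1 hz0.symm).resolve_left (sideSign_ne_zero _ _)
    refine ⟨c, ?_, Sym2.mem_mk_left _ _, eq_posB_apex hc h0 (by rw [hz1, hw0]; ring)⟩
    rw [Sym2.mem_iff, Fin.ext_iff, Fin.ext_iff]
    omega
  -- the edge between the apices and an edge of the path on one side of it
  have h13 : ∀ a b u v : Fin n, a.val = 0 → b.val = 1 → 2 ≤ u.val → v.val = u.val + 1 →
      u.val ≠ k + 1 → z ∈ segment ℝ (posB n a) (posB n b) →
      z ∈ segment ℝ (posB n u) (posB n v) → False := by
    intro a b u v ha hb hu hv huk h h'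
    obtain ⟨h0, -⟩ := of_mem_segment_apices ha hb h
    obtain ⟨w, hw, hz0, -⟩ := exists_of_mem_segment_path hu hv hk huk h'
    rw [h0] at hz0
    exact hw.ne' ((mul_eq_zero.1 hz0.symm).resolve_left (sideSign_ne_zero _ _))
  -- the edge between the apices and the edge of the path that crosses their line
  have h14 : ∀ a b u v : Fin n, a.val = 0 → b.val = 1 → 2 ≤ u.val → v.val = u.val + 1 →
      u.val = k + 1 → z ∈ segment ℝ (posB n a) (posB n b) →
      z ∈ segment ℝ (posB n u) (posB n v) → False := by
    intro a b u v ha hb hu hv huk h h'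
    obtain ⟨-, h1⟩ := of_mem_segment_apices ha hb h
    have := apply_one_of_mem_segment_bottom hu hv hk huk h'
    linarith
  -- two edges between apices and the path
  have h22 : ∀ c v c' v' : Fin n, c.val < 2 → 2 ≤ v.val → c'.val < 2 → 2 ≤ v'.val →
      s(c, v) ≠ s(c', v') → z ∈ segment ℝ (posB n c) (posB n v) →
      z ∈ segment ℝ (posB n c') (posB n v') →
      ∃ w, w ∈ s(c, v) ∧ w ∈ s(c', v') ∧ z = posB n w := by
    intro c v c' v' hc hv hc' hv' hne h h'
    obtain ⟨w, hw, hrw, hz0, hz1⟩ := exists_of_mem_segment_apex hc hv hk h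
    obtain ⟨w', hw', hrw', hz0', hz1'⟩ := exists_of_mem_segment_apex hc' hv' hk h'
    rcases sideSign_mul_eq hw hw' (hz0.symm.trans hz0') with ⟨hs, rfl⟩ | ⟨rfl, rfl⟩
    · by_cases hcc : c = c'
      · subst hcc
        refine ⟨c, Sym2.mem_mk_left _ _, Sym2.mem_mk_left _ _, ?_⟩
        have hvv : invDist k v.val v.val ≠ invDist k v'.val v'.val := by
          rw [invDist_congr hs]
          intro h
          apply hne
          rw [Fin.ext (by exact_mod_cast invDist_injective _ _ h : v.val = v'.val)]
        have h2 : (2 - apexHeight c.val) ≠ 0 := by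
          unfold apexHeight; split_ifs <;> norm_num
        have hw0 : w = 0 := by
          have h3 : (2 - apexHeight c.val) * ((invDist k v.val v.val - invDist k v'.val v'.val) * w)
              = 0 := by
            linarith [hz1.symm.trans hz1']
          exact ((mul_eq_zero.1 ((mul_eq_zero.1 h3).resolve_left h2)).resolve_left
            (sub_ne_zero.2 hvv))
        exact eq_posB_apex hc (by rw [hz0, hw0]; ring) (by rw [hz1, hw0]; ring)
      · have hcc' : (c.val = 0 ∧ c'.val = 1) ∨ (c.val = 1 ∧ c'.val = 0) := by
          rw [Fin.ext_iff] at hcc; omega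
        have h1 : invDist k v.val v.val * w = 1 ∧ invDist k v'.val v'.val * w = 1 := by
          have := hz1.symm.trans hz1'
          rcases hcc' with ⟨e1, e2⟩ | ⟨e1, e2⟩ <;> simp [apexHeight, e1, e2] at this <;>
            constructor <;> linarith
        have hw0 : w ≠ 0 := by rintro rfl; simp at h1
        have h2 : invDist k v.val v.val = invDist k v'.val v'.val :=
          mul_right_cancel₀ hw0 (h1.1.trans h1.2.symm)
        rw [invDist_congr hs] at h2
        have hvv : v = v' := Fin.ext (by exact_mod_cast invDist_injective _ _ h2)
        subst hvv
        exact ⟨v, Sym2.mem_mk_right _ _, Sym2.mem_mk_right _ _,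
          eq_posB_path hv hk hz0 (by rw [hz1, h1.1]; ring) h1.1⟩
    · have hcc : c = c' := by
        have := hz1.symm.trans hz1'
        simp [apexHeight] at this
        ext
        split_ifs at this <;> first | omega | norm_num at this
      subst hcc
      exact ⟨c, Sym2.mem_mk_left _ _, Sym2.mem_mk_left _ _,
        eq_posB_apex hc (by rw [hz0]; ring) (by rw [hz1]; ring)⟩
  -- an edge between an apex and the path and an edge of the path
  have h23 : ∀ c v x y : Fin n, c.val < 2 → 2 ≤ v.val → 2 ≤ x.val → y.val = x.val + 1 →
      x.val ≠ k + 1 → z ∈ segment ℝ (posB n c) (posB n v) →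
      z ∈ segment ℝ (posB n x) (posB n y) → ∃ w, w ∈ s(c, v) ∧ w ∈ s(x, y) ∧ z = posB n w := by
    intro c v x y hc hv hx hy hxk h h'
    obtain ⟨w, hw, hrw, hz0, hz1⟩ := exists_of_mem_segment_apex hc hv hk h
    obtain ⟨w', hw', hz0', hz1', τ, hτ, hτ', hτw⟩ := exists_of_mem_segment_path hx hy hk hxk h'
    rcases sideSign_mul_eq hw hw'.le (hz0.symm.trans hz0') with ⟨hs, rfl⟩ | ⟨-, h0⟩
    swap
    · exact absurd h0 hw'.ne'
    have h2 : (2 - apexHeight c.val) ≠ 0 := by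
      unfold apexHeight; split_ifs <;> norm_num
    have h1 : invDist k v.val v.val * w = 1 := by
      have h3 : (2 - apexHeight c.val) * (invDist k v.val v.val * w - 1) = 0 := by
        linarith [hz1.symm.trans hz1']
      linarith [(mul_eq_zero.1 h3).resolve_left h2]
    have h4 : τ = v.val := by
      rw [← invDist_congr hs] at hτw
      exact invDist_injective _ _ (mul_right_cancel₀ hw'.ne' (hτw.trans h1.symm))
    refine ⟨v, Sym2.mem_mk_right _ _, ?_, eq_posB_path hv hk hz0 hz1' h1⟩
    rw [h4] at hτ hτ'
    have h5 : x.val ≤ v.val := by exact_mod_cast hτ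
    have h6 : v.val ≤ y.val := by exact_mod_cast hτ'
    rw [Sym2.mem_iff, Fin.ext_iff, Fin.ext_iff]
    omega
  have h24 : ∀ c v x y : Fin n, c.val < 2 → 2 ≤ v.val → 2 ≤ x.val → y.val = x.val + 1 →
      x.val = k + 1 → z ∈ segment ℝ (posB n c) (posB n v) →
      z ∈ segment ℝ (posB n x) (posB n y) → ∃ w, w ∈ s(c, v) ∧ w ∈ s(x, y) ∧ z = posB n w := by
    intro c v x y hc hv hx hy hxk h h'
    obtain ⟨w, hw, hrw, hz0, hz1⟩ := exists_of_mem_segment_apex hc hv hk h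
    have hz1' := apply_one_of_mem_segment_bottom hx hy hk hxk h'
    have hRv := hR v.val
    set r := invDist k v.val v.val with hr
    have hw1 : w ≤ 1 := by nlinarith
    have h1 : r = 1 ∧ w = 1 := by
      by_cases hc0 : c.val = 0
      · simp only [apexHeight, hc0, if_true] at hz1
        have : 1 ≤ w := by nlinarith
        obtain rfl : w = 1 := le_antisymm hw1 this
        exact ⟨by linarith, rfl⟩
      · simp only [apexHeight, hc0, if_false] at hz1
        have e1 : w * ((k : ℝ) + 1 - 2 * r) = k - 1 := by linarith
        have e2 : 0 < (k : ℝ) + 1 - 2 * r := by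
          by_contra hcon
          nlinarith [mul_nonneg hw (sub_nonneg.2 (not_lt.1 hcon))]
        have e3 : r * ((k : ℝ) - 1) ≤ k + 1 - 2 * r := by
          rw [← e1]
          nlinarith
        have e4 : r = 1 := le_antisymm (by nlinarith) hRv
        refine ⟨e4, ?_⟩
        rw [e4] at e1
        have : (w - 1) * ((k : ℝ) - 1) = 0 := by linarith
        rcases mul_eq_zero.1 this with h | h <;> linarith
    refine ⟨v, Sym2.mem_mk_right _ _, ?_, eq_posB_path hv hk hz0 ?_ ?_⟩
    · have := invDist_eq_one_iff.1 h1.1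
      rw [Sym2.mem_iff, Fin.ext_iff, Fin.ext_iff]
      omega
    · rw [hz1', h1.2]; ring
    · rw [← hr, h1.1, h1.2, mul_one]
  -- two edges of the path
  have h33' : ∀ x y x' y' : Fin n, 2 ≤ x.val → y.val = x.val + 1 → x.val ≠ k + 1 → 2 ≤ x'.val →
      y'.val = x'.val + 1 → x'.val ≠ k + 1 → x.val < x'.val →
      z ∈ segment ℝ (posB n x) (posB n y) → z ∈ segment ℝ (posB n x') (posB n y') →
      ∃ w, w ∈ s(x, y) ∧ w ∈ s(x', y') ∧ z = posB n w := by
    intro x y x' y' hx hy hxk hx' hy' hxk' hlt h h'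
    obtain ⟨w, hw, hz0, hz1, τ, hτ₁, hτ₂, hτw⟩ := exists_of_mem_segment_path hx hy hk hxk h
    obtain ⟨w', hw', hz0', hz1', τ', hτ₁', hτ₂', hτw'⟩ :=
      exists_of_mem_segment_path hx' hy' hk hxk' h'
    rcases sideSign_mul_eq hw.le hw'.le (hz0.symm.trans hz0') with ⟨hs, rfl⟩ | ⟨-, h0⟩
    swap
    · exact absurd h0 hw'.ne'
    have hττ : τ = τ' := by
      rw [← invDist_congr hs] at hτw'
      exact invDist_injective _ _ (mul_right_cancel₀ hw.ne' (hτw.trans hτw'.symm))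
    subst hττ
    have h1 : x'.val ≤ y.val := by exact_mod_cast hτ₁'.trans hτ₂
    have h2 : x' = y := Fin.ext (by omega)
    subst h2
    refine ⟨x', Sym2.mem_mk_right _ _, Sym2.mem_mk_left _ _, eq_posB_path hx' hk hz0' hz1' ?_⟩
    rw [← hτw', le_antisymm hτ₂ hτ₁']
  have h33 : ∀ x y x' y' : Fin n, 2 ≤ x.val → y.val = x.val + 1 → x.val ≠ k + 1 → 2 ≤ x'.val →
      y'.val = x'.val + 1 → x'.val ≠ k + 1 → s(x, y) ≠ s(x', y') →
      z ∈ segment ℝ (posB n x) (posB n y) → z ∈ segment ℝ (posB n x') (posB n y') →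
      ∃ w, w ∈ s(x, y) ∧ w ∈ s(x', y') ∧ z = posB n w := by
    intro x y x' y' hx hy hxk hx' hy' hxk' hne h h'
    rcases lt_trichotomy x.val x'.val with hlt | heq | hlt
    · exact h33' x y x' y' hx hy hxk hx' hy' hxk' hlt h h'
    · exact absurd (by rw [Fin.ext heq, Fin.ext (show y.val = y'.val by omega)]) hne
    · exact hswap (h33' x' y' x y hx' hy' hxk' hx hy hxk hlt h' h)
  have h34 : ∀ x y x' y' : Fin n, 2 ≤ x.val → y.val = x.val + 1 → x.val ≠ k + 1 → 2 ≤ x'.val →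
      y'.val = x'.val + 1 → x'.val = k + 1 →
      z ∈ segment ℝ (posB n x) (posB n y) → z ∈ segment ℝ (posB n x') (posB n y') →
      ∃ w, w ∈ s(x, y) ∧ w ∈ s(x', y') ∧ z = posB n w := by
    intro x y x' y' hx hy hxk hx' hy' hxk' h h'
    obtain ⟨w, hw, hz0, hz1, τ, hτ₁, hτ₂, hτw⟩ := exists_of_mem_segment_path hx hy hk hxk h
    have hz1' := apply_one_of_mem_segment_bottom hx' hy' hk hxk' h'
    have hw1 : w = 1 := by
      have : ((k : ℝ) + 1) * (w - 1) = 0 := by linarith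
      linarith [(mul_eq_zero.1 this).resolve_left (by linarith)]
    subst hw1
    rw [mul_one] at hτw
    by_cases hl : x.val ≤ k + 1
    · have hτ : τ = (k + 1 : ℕ) := by
        simp only [invDist, hl, if_true] at hτw
        push_cast; linarith
      rw [hτ] at hτ₂
      have h1 : k + 1 ≤ y.val := by exact_mod_cast hτ₂
      have h2 : y = x' := Fin.ext (by omega)
      subst h2
      refine ⟨y, Sym2.mem_mk_right _ _, Sym2.mem_mk_left _ _, eq_posB_path (w := 1) hx' hk ?_ hz1 ?_⟩
      · rw [hz0, sideSign_congr (show x.val ≤ k + 1 ↔ y.val ≤ k + 1 by omega)]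
      · rw [mul_one, invDist_eq_one_iff]; omega
    · have hτ : τ = (k + 2 : ℕ) := by
        simp only [invDist, hl, if_false] at hτw
        push_cast; linarith
      rw [hτ] at hτ₁
      have h1 : x.val ≤ k + 2 := by exact_mod_cast hτ₁
      have h2 : x = y' := Fin.ext (by omega)
      subst h2
      refine ⟨x, Sym2.mem_mk_left _ _, Sym2.mem_mk_right _ _, eq_posB_path (w := 1) hx hk hz0 hz1 ?_⟩
      rw [mul_one, invDist_eq_one_iff]; omega
  rcases edge_cases hn k he with rfl | ⟨c, v, hc, hv, rfl⟩ | ⟨x, y, hx, hy, hxk, rfl⟩ |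
      ⟨x, y, hx, hy, hxk, rfl⟩ <;>
    rcases edge_cases hn k hf with rfl | ⟨c', v', hc', hv', rfl⟩ | ⟨x', y', hx', hy', hxk', rfl⟩ |
      ⟨x', y', hx', hy', hxk', rfl⟩
  · exact absurd rfl hef
  · exact h12 _ _ _ _ rfl rfl hc' hv' hze hzf
  · exact (h13 _ _ _ _ rfl rfl hx' hy' hxk' hze hzf).elim
  · exact (h14 _ _ _ _ rfl rfl hx' hy' hxk' hze hzf).elim
  · exact hswap (h12 _ _ _ _ rfl rfl hc hv hzf hze)
  · exact h22 _ _ _ _ hc hv hc' hv' hef hze hzf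
  · exact h23 _ _ _ _ hc hv hx' hy' hxk' hze hzf
  · exact h24 _ _ _ _ hc hv hx' hy' hxk' hze hzf
  · exact (h13 _ _ _ _ rfl rfl hx hy hxk hzf hze).elim
  · exact hswap (h23 _ _ _ _ hc' hv' hx hy hxk hzf hze)
  · exact h33 _ _ _ _ hx hy hxk hx' hy' hxk' hef hze hzf
  · exact h34 _ _ _ _ hx hy hxk hx' hy' hxk' hze hzf
  · exact (h14 _ _ _ _ rfl rfl hx hy hxk hzf hze).elim
  · exact hswap (h24 _ _ _ _ hc' hv' hx hy hxk hzf hze)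
  · exact hswap (h34 _ _ _ _ hx' hy' hxk' hx hy hxk hzf hze)
  · exact absurd (by rw [Fin.ext (hxk.trans hxk'.symm), Fin.ext (show y.val = y'.val by omega)]) hef

lemma isCrossingFree_posB {n : ℕ} (hn : 6 ≤ n) :
    IsCrossingFree (graphB n) (posB n) (edgeSegment (posB n)) := by
  have hedge : ∀ e ∈ (graphB n).edgeSet, ∀ f ∈ (graphB n).edgeSet, e ≠ f →
      ∀ x ∈ edgeSegment (posB n) e ∩ edgeSegment (posB n) f,
        ∃ w : Fin n, w ∈ e ∧ w ∈ f ∧ x = posB n w :=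
    fun e he f hf hef x hx => posB_edge hn he hf hef hx.1 hx.2
  refine ⟨posB_injective n, fun e he w hw => ?_, hedge⟩
  -- An edge that passes through `w` meets every edge at `w`, hence has `w` as an end.
  by_contra hwe
  obtain ⟨u, hu⟩ : ∃ u, (graphB n).Adj w u := by
    by_cases hw0 : w = ⟨0, by omega⟩
    · exact ⟨⟨1, by omega⟩, graphB_adj_of_lt_two (by simp [hw0]) (by simp [hw0])⟩
    · exact ⟨⟨0, by omega⟩, (graphB_adj_of_lt_two (by simp) hw0).symm⟩
  obtain ⟨v, hv, -, hwv⟩ := hedge e he s(w, u) hu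
    (fun h => hwe (h ▸ Sym2.mem_mk_left w u)) (posB n w) ⟨hw, left_mem_segment ℝ _ _⟩
  exact hwe (posB_injective n hwv ▸ hv)

/-- The drawing of `graphB n` given by `posB n`. -/
noncomputable def drawingB {n : ℕ} (hn : 6 ≤ n) : StraightLineDrawing (graphB n) :=
  ⟨posB n, isCrossingFree_posB hn⟩

/-- Three consecutive vertices of the path on one side of the line through the apices are
collinear. -/
lemma sbtw_posB_path {n : ℕ} {u v w : Fin n} (hu : 2 ≤ u.val) (hv : v.val = u.val + 1)
    (hw : w.val = v.val + 1) {k : ℕ} (hk : k = (n - 1) / 2) (huk : u.val ≠ k + 1)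
    (hvk : v.val ≠ k + 1) : Sbtw ℝ (posB n u) (posB n v) (posB n w) := by
  have h1 : u.val ≤ k + 1 ↔ v.val ≤ k + 1 := by omega
  have h2 : u.val ≤ k + 1 ↔ w.val ≤ k + 1 := by omega
  have hR₁ := one_le_invDist (k := k) (i := u.val)
  have hR₂ := one_le_invDist (k := k) (i := v.val)
  have hR₃ := one_le_invDist (k := k) (i := w.val)
  have hv' : (v.val : ℝ) = u.val + 1 := by exact_mod_cast hv
  have hw' : (w.val : ℝ) = u.val + 2 := by rw [hw]; push_cast; rw [hv']; ring
  -- Both rays are parametrised by the distance from the line through the apices.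
  let q : ℝ → Plane := fun t => !₂[sideSign k u.val * t, 2 - (k + 1) * t]
  have hq : ∀ t, q t = AffineMap.lineMap (q 0) (q 1) t := by
    intro t
    rw [AffineMap.lineMap_apply_module]
    ext i; fin_cases i
    · simp [q]; ring
    · simp [q]; ring
  have hq01 : q 0 ≠ q 1 := by
    intro h
    have := congrArg (fun x : Plane => x 0) h
    simp [q] at this
    exact sideSign_ne_zero _ _ this.symm
  have e1 : posB n u = q (invDist k u.val u.val)⁻¹ := posB_path hu hk
  have e2 : posB n v = q (invDist k v.val v.val)⁻¹ := by
    rw [posB_path (by omega) hk, ← sideSign_congr h1]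
  have e3 : posB n w = q (invDist k w.val w.val)⁻¹ := by
    rw [posB_path (by omega) hk, ← sideSign_congr h2]
  rw [e1, e2, e3, hq (invDist k u.val u.val)⁻¹, hq (invDist k v.val v.val)⁻¹,
    hq (invDist k w.val w.val)⁻¹, (AffineMap.lineMap_injective ℝ hq01).sbtw_map_iff]
  rw [← invDist_congr h1] at hR₂ ⊢
  rw [← invDist_congr h2] at hR₃ ⊢
  by_cases hl : u.val ≤ k + 1
  · simp only [invDist, hl, if_true, hv', hw'] at hR₁ hR₂ hR₃ ⊢
    exact sbtw_of_lt_of_lt (inv_strictAnti₀ (by linarith) (by linarith))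
      (inv_strictAnti₀ (by linarith) (by linarith))
  · simp only [invDist, hl, if_false, hv', hw'] at hR₁ hR₂ hR₃ ⊢
    exact (sbtw_of_lt_of_lt (inv_strictAnti₀ (by linarith) (by linarith))
      (inv_strictAnti₀ (by linarith) (by linarith))).symm

/-- The lower apex is between each path vertex on the left and its counterpart on the right. -/
lemma sbtw_posB_apex {n : ℕ} {u c v : Fin n} (hu : 2 ≤ u.val) (hc : c.val = 1) {k : ℕ}
    (hk : k = (n - 1) / 2) (huk : u.val ≤ k + 1) (hv : v.val = u.val + k) :
    Sbtw ℝ (posB n u) (posB n c) (posB n v) := by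
  have hvk : ¬ v.val ≤ k + 1 := by omega
  have hR := one_le_invDist (k := k) (i := u.val)
  have hR' := one_le_invDist (k := k) (i := v.val)
  have hinj := posB_injective n
  have hv' : (v.val : ℝ) = u.val + k := by exact_mod_cast hv
  refine ⟨⟨invDist k v.val v.val / (k + 1), ⟨by positivity, ?_⟩, ?_⟩, ?_, ?_⟩
  · rw [div_le_one (by positivity)]
    simp only [invDist, huk, hvk, if_true, if_false, hv'] at hR hR' ⊢
    linarith
  · have e : (k : ℝ) + 1 = invDist k u.val u.val + invDist k v.val v.val := by
      simp only [invDist, huk, hvk, if_true, if_false, hv']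
      ring
    rw [posB_path hu hk, posB_path (by omega) hk, posB_apex (by omega), e]
    have h1 : sideSign k u.val = -1 := by simp [sideSign, huk]
    have h2 : sideSign k v.val = 1 := by simp [sideSign, hvk]
    set r := invDist k u.val u.val
    set r' := invDist k v.val v.val
    have : r ≠ 0 := by linarith
    have : r' ≠ 0 := by linarith
    have : r + r' ≠ 0 := by linarith
    rw [AffineMap.lineMap_apply_module]
    ext i; fin_cases i
    · simp [h1, h2]
      field_simp
      ring
    · simp [apexHeight, hc]
      field_simp
      ring
  · intro h
    have := congrArg Fin.val (hinj h)
    omega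
  · intro h
    have := congrArg Fin.val (hinj h)
    omega

theorem seg_graphB_le (n : ℕ) (hn : 6 ≤ n) :
    seg (graphB n) ≤ ((n + (n + 1) / 2 + 1 : ℕ) : ℕ∞) := by
  obtain ⟨k, hk⟩ : ∃ k, k = (n - 1) / 2 := ⟨_, rfl⟩
  let a : Fin n := ⟨0, by omega⟩
  let b : Fin n := ⟨1, by omega⟩
  have ha : a.val = 0 := rfl
  have hb : b.val = 1 := rfl
  -- The edges at the upper apex, those between the lower apex and the left part of the path, and
  -- one edge for each of the three segments of the path.
  let R : Finset (Sym2 (Fin n)) := (Finset.univ.erase a).image (fun v => s(a, v)) ∪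
    (Finset.univ.filter fun v : Fin n => 2 ≤ v.val ∧ v.val ≤ k + 1).image (fun v => s(b, v)) ∪
    {s(⟨2, by omega⟩, ⟨3, by omega⟩), s(⟨k + 1, by omega⟩, ⟨k + 2, by omega⟩),
      s(⟨k + 2, by omega⟩, ⟨k + 3, by omega⟩)}
  have hRc : R.card ≤ n + (n + 1) / 2 + 1 := by
    have h1 : ((Finset.univ.erase a).image fun v => s(a, v)).card ≤ n - 1 := by
      refine Finset.card_image_le.trans ?_
      rw [Finset.card_erase_of_mem (Finset.mem_univ _), Finset.card_fin]
    have h2 : ((Finset.univ.filter fun v : Fin n => 2 ≤ v.val ∧ v.val ≤ k + 1).image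
        fun v => s(b, v)).card ≤ k := by
      refine Finset.card_image_le.trans ?_
      refine (Finset.card_le_card_of_injOn (t := Finset.Icc 2 (k + 1)) Fin.val ?_
        Fin.val_injective.injOn).trans (by rw [Nat.card_Icc]; omega)
      intro v hv
      simpa using hv
    refine (Finset.card_union_le _ _).trans ?_
    refine (add_le_add ((Finset.card_union_le _ _).trans (add_le_add h1 h2))
      Finset.card_le_three).trans ?_
    omega
  refine (iInf_le _ (drawingB hn)).trans
    (((drawingB hn).encard_segments_le R ?_).trans (by exact_mod_cast hRc))
  intro S hS
  obtain ⟨e, he⟩ := (drawingB hn).nonempty_of_mem_segments hS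
  -- A segment that contains an edge of the path contains the first edge on the same side.
  have hback : ∀ u v w : Fin n, 2 ≤ u.val → v.val = u.val + 1 → w.val = v.val + 1 →
      u.val ≠ k + 1 → v.val ≠ k + 1 → s(v, w) ∈ S → s(u, v) ∈ S := by
    intro u v w hu hv hw huk hvk hS'
    rw [Sym2.eq_swap]
    refine (drawingB hn).mem_of_sbtw hS (u := w) (by rwa [Sym2.eq_swap])
      (graphB_adj_succ hv).symm ?_
    exact (sbtw_posB_path hu hv hw hk huk hvk).symm
  have hpath : ∀ d i₀ : ℕ, 2 ≤ i₀ → (i₀ + d ≤ k ∨ k + 2 ≤ i₀) → ∀ x y u v : Fin n, x.val = i₀ →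
      y.val = i₀ + 1 → u.val = i₀ + d → v.val = i₀ + d + 1 → s(u, v) ∈ S → s(x, y) ∈ S := by
    intro d i₀ h2 hside x y
    induction d with
    | zero =>
      intro u v hx hy hu hv h
      rwa [show x = u from Fin.ext (by omega), show y = v from Fin.ext (by omega)]
    | succ d ih =>
      intro u v hx hy hu hv h
      exact ih (by omega) ⟨i₀ + d, by omega⟩ u hx hy rfl (by omega)
        (hback _ u v (by simp only; omega) hu (by omega) (by simp only; omega) (by omega) h)
  have hk₁ : k + 1 < n := by omega
  have hk₂ : k + 2 < n := by omega
  have heG : e ∈ (graphB n).edgeSet := ((drawingB hn).mem_segments.1 hS).prop.1 he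
  rcases edge_cases hn k heG with rfl | ⟨c, v, hc, hv, rfl⟩ | ⟨u, v, hu, hv, huk, rfl⟩ |
      ⟨u, v, hu, hv, huk, rfl⟩
  · refine ⟨_, ?_, he⟩
    exact Finset.mem_union_left _ (Finset.mem_union_left _
      (Finset.mem_image.2 ⟨b, by simp [a, b], rfl⟩))
  · by_cases hc0 : c.val = 0
    · obtain rfl : c = a := Fin.ext hc0
      refine ⟨_, ?_, he⟩
      refine Finset.mem_union_left _ (Finset.mem_union_left _ (Finset.mem_image.2 ⟨v, ?_, rfl⟩))
      simp only [Finset.mem_erase, Finset.mem_univ, and_true, ne_eq, Fin.ext_iff]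
      omega
    · obtain rfl : c = b := Fin.ext (by omega)
      by_cases hvk : v.val ≤ k + 1
      · exact ⟨_, Finset.mem_union_left _ (Finset.mem_union_right _ (Finset.mem_image.2
          ⟨v, by simp [hv, hvk], rfl⟩)), he⟩
      · let u : Fin n := ⟨v.val - k, by omega⟩
        have hu : u.val = v.val - k := rfl
        refine ⟨s(b, u), Finset.mem_union_left _ (Finset.mem_union_right _ (Finset.mem_image.2
          ⟨u, ?_, rfl⟩)), ?_⟩
        · simp only [Finset.mem_filter, Finset.mem_univ, true_and]
          omega
        · refine (drawingB hn).mem_of_sbtw hS (u := v) (by rwa [Sym2.eq_swap])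
            (graphB_adj_of_lt_two (by omega) (fun h => ?_)) ?_
          · have := congrArg Fin.val h
            omega
          · exact (sbtw_posB_apex (by omega) hb hk (by omega) (by omega)).symm
  · by_cases hl : u.val ≤ k
    · refine ⟨_, Finset.mem_union_right _ (by simp), hpath (u.val - 2) 2 le_rfl (by omega)
        ⟨2, by omega⟩ ⟨3, by omega⟩ u v rfl rfl (by omega) (by omega) he⟩
    · refine ⟨_, Finset.mem_union_right _ (by simp), hpath (u.val - (k + 2)) (k + 2) (by omega)
        (by omega) ⟨k + 2, by omega⟩ ⟨k + 3, by omega⟩ u v rfl rfl (by omega) (by omega) he⟩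
  · obtain rfl : u = ⟨k + 1, hk₁⟩ := Fin.ext huk
    obtain rfl : v = ⟨k + 2, hk₂⟩ := Fin.ext hv
    exact ⟨_, Finset.mem_union_right _ (by simp), he⟩

/-! ### Planarity and the stacking order -/

lemma StraightLineDrawing.isPlanar {V : Type*} {G : SimpleGraph V} (Γ : StraightLineDrawing G) :
    IsPlanar G := by
  refine ⟨Γ.pos, edgeSegment Γ.pos, Γ.crossingFree, fun u v huv => ?_⟩
  refine ⟨⟨⟨fun t => AffineMap.lineMap (Γ.pos u) (Γ.pos v) (t : ℝ), ?_⟩, by simp, by simp⟩, ?_, ?_⟩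
  · exact AffineMap.lineMap_continuous.comp continuous_subtype_val
  · intro s t h
    exact Subtype.ext (AffineMap.lineMap_injective ℝ (Γ.pos_ne huv) h)
  · rw [edgeSegment_mk, segment_eq_image_lineMap]
    ext x
    constructor
    · rintro ⟨t, rfl⟩; exact ⟨t, t.2, rfl⟩
    · rintro ⟨t, ht, rfl⟩; exact ⟨⟨t, ht⟩, rfl⟩

lemma isKTree_graphB {n : ℕ} (hn : 6 ≤ n) : IsKTree 3 (graphB n) := by
  refine ⟨n, Equiv.refl _, by omega, ?_, ?_⟩
  · intro i j hi hj hij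
    have := Fin.val_ne_of_ne hij
    simp only [Equiv.refl_apply, graphB_adj]
    exact ⟨hij, by omega⟩
  · intro i hi
    refine ⟨{⟨0, by omega⟩, ⟨1, by omega⟩, ⟨i.val - 1, by omega⟩}, ?_, ?_⟩
    · rw [SimpleGraph.is3Clique_triple_iff]
      simp only [graphB_adj, ne_eq, Fin.ext_iff]
      exact ⟨⟨by omega, Or.inr (Or.inl trivial)⟩, ⟨by omega, by omega⟩, ⟨by omega, by omega⟩⟩
    · intro u
      simp only [Finset.mem_insert, Finset.mem_singleton, Equiv.refl_apply, Equiv.refl_symm,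
        graphB_adj, Fin.lt_def, ne_eq, Fin.ext_iff]
      omega

/-! ### The segment number of `graphB` -/

theorem mainTheorem12 (n : ℕ) (hn : 6 ≤ n) :
    IsPlanar (graphB n) ∧ IsKTree 3 (graphB n) ∧
      seg (graphB n) = ((⌈(3 * n : ℚ) / 2⌉₊ + 1 : ℕ) : ℕ∞) := by
  refine ⟨(drawingB hn).isPlanar, isKTree_graphB hn, ?_⟩
  have h : ⌈(3 * n : ℚ) / 2⌉₊ = n + (n + 1) / 2 := by
    rw [Nat.ceil_eq_iff (by omega)]
    obtain ⟨m, rfl | rfl⟩ := Nat.even_or_odd' n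
    · rw [show (2 * m + 1) / 2 = m by omega, Nat.cast_sub (by omega)]
      push_cast
      constructor <;> linarith
    · rw [show (2 * m + 1 + 1) / 2 = m + 1 by omega, Nat.cast_sub (by omega)]
      push_cast
      constructor <;> linarith
  rw [h]
  exact le_antisymm (seg_graphB_le n hn) (le_seg_graphB n hn)
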